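/- Fix an integer $d\ge 2$ and vertices $v_1,v_2,\dots$. The max-choice preferential attachment tree is the following sequence of random trees $P_1,P_2,\dots$. The tree $P_1$ consists of the single edge $v_1v_2$. Given $P_n$, which is a tree on $v_1,\dots,v_{n+1}$, let $\mathcal F_n$ be the $\sigma$-algebra generated by the edge sets of $P_1,\dots,P_n$ and let $\deg v_i(n)$ be the degree of $v_i$ in $P_n$ (with $\deg v_i(n)=0$ if $i>n+1$). Let $X_n^1,\dots,X_n^d$ be vertices of $P_n$ that are, conditionally on $\mathcal F_n$, independent and identically distributed with $$\mathbb P\left[X_n^1=v_i\mid\mathcal F_n\right]=\frac{\deg v_i(n)}{2n},\qquad 1\le i\le n+1.$$ Let $Y_n$ be the one of $X_n^1,\dots,X_n^d$ with the largest degree in $P_n$; in the case of a tie, $Y_n$ is chosen uniformly at random among the tied sampled vertices (conditionally on $\mathcal F_n$ and $X_n^1,\dots,X_n^d$). The tree $P_{n+1}$ is $P_n$ together with the new vertex $v_{n+2}$ and a new edge between $v_{n+2}$ and $Y_n$. Let $M_1(n)\ge M_2(n)\ge\cdots$ be the degrees of the vertices of $P_n$ listed in decreasing order with multiplicity, with $M_l(n)=1$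 if $P_n$ has fewer than $l$ vertices. **Proposition.** For every $k\in\mathbb N$ there exist random variables $N_l$ and $K_l$, $1\le l\le k$, with values in the natural numbers, such that almost surely, for every $1\le l\le k$ and at every time $n\ge N_l$, $$\deg v_{K_l}(n)=M_l(n)\qquad\text{and}\qquad M_1(n)>M_2(n)>\cdots>M_l(n)>\deg v_i(n)\quad\text{for every } i\notin\{K_1,\dots,K_l\}.$$ -/

import Mathlib

open MeasureTheory
open scoped ProbabilityTheory

namespace MaxChoice

/-- The tree `P_n` on the vertices `v_1, …, v_{n+1}` determined by the attachment choices
`y 1, y 2, …` (`y n` is the index of the vertex to which `v_{n+2}` is joined): `P_1` is the single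
edge `v_1 v_2`, and `P_{n+1}` is `P_n` with the new edge `v_{n+2} v_{y n}`. The vertex `v_i` is
represented by the natural number `i`; numbers outside `{1, …, n+1}` are isolated in `P_n`.
(Time starts at `1`; the value at `0` is the one-vertex tree and `y 0` is never used.) -/
def tree (y : ℕ → ℕ) : ℕ → SimpleGraph ℕ
  | 0 => ⊥
  | 1 => SimpleGraph.edge 1 2
  | n + 2 => tree y (n + 1) ⊔ SimpleGraph.edge (n + 3) (y (n + 1))

/-- The degree of the vertex `v_i` in `P_n`. -/
noncomputable def deg (y : ℕ → ℕ) (n i : ℕ) : ℕ :=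
  ((tree y n).neighborSet i).ncard

/-- `M_l(n)` for `l ≥ 1`: the `l`-th entry of the list of the degrees in `P_n` of
`v_1, …, v_{n+1}` (with multiplicity), sorted in decreasing order; it is `1` if `P_n` has fewer
than `l` vertices. -/
noncomputable def maxDeg (y : ℕ → ℕ) (l n : ℕ) : ℕ :=
  (((Finset.Icc 1 (n + 1)).val.map (deg y n)).sort (· ≥ ·)).getD (l - 1) 1

/-- The vertices of largest degree in `P_n` among the sampled vertices `x 0, …, x (d-1)`. -/
noncomputable def winners {d : ℕ} (y : ℕ → ℕ) (n : ℕ) (x : Fin d → ℕ) : Finset ℕ :=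
  (Finset.univ.image x).filter fun i => ∀ j, deg y n (x j) ≤ deg y n i

/-- The σ-algebra `𝓕_n` generated by the edge sets of `P_1, …, P_n`. -/
abbrev history {Ω : Type*} (Y : ℕ → Ω → ℕ) (n : ℕ) : MeasurableSpace Ω :=
  ⨆ m ∈ Finset.Icc 1 n,
    MeasurableSpace.comap (fun ω => (tree (fun i => Y i ω) m).edgeSet) inferInstance

/-- `X` and `Y` are the samples and the attachment choices of a max-choice preferential attachment
tree with `d` choices, on the probability space `(Ω, μ)`. The tree at time `n` in the outcome `ω`
is `tree (fun i => Y i ω) n`. -/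
structure IsMaxChoiceTree {Ω : Type*} [MeasurableSpace Ω] (μ : Measure Ω) (d : ℕ)
    (X : ℕ → Fin d → Ω → ℕ) (Y : ℕ → Ω → ℕ) : Prop where
  measurable_X : ∀ n, 1 ≤ n → ∀ j, Measurable (X n j)
  measurable_Y : ∀ n, 1 ≤ n → Measurable (Y n)
  /-- The samples at step `n` are vertices of `P_n`. -/
  X_mem : ∀ n, 1 ≤ n → ∀ j ω, X n j ω ∈ Finset.Icc 1 (n + 1)
  /-- Given `𝓕_n`, the `d` samples are independent, each equal to `v_i` with probability
  `deg v_i(n) / (2n)`. -/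
  X_law : ∀ n, 1 ≤ n → ∀ x : Fin d → ℕ,
    μ⟦{ω | ∀ j, X n j ω = x j} | history Y n⟧ =ᵐ[μ]
      fun ω => ∏ j, (deg (fun i => Y i ω) n (x j) : ℝ) / (2 * n)
  /-- `Y_n` is a sampled vertex of largest degree. -/
  Y_mem : ∀ n, 1 ≤ n → ∀ ω, Y n ω ∈ winners (fun i => Y i ω) n (fun j => X n j ω)
  /-- Ties are broken fairly: given `𝓕_n` and the samples, `Y_n` is uniform on the sampled
  vertices of largest degree. -/
  Y_law : ∀ n, 1 ≤ n → ∀ v : ℕ,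
    μ⟦{ω | Y n ω = v} | history Y n ⊔ ⨆ j, MeasurableSpace.comap (X n j) inferInstance⟧ =ᵐ[μ]
      fun ω => if v ∈ winners (fun i => Y i ω) n (fun j => X n j ω)
        then ((winners (fun i => Y i ω) n (fun j => X n j ω)).card : ℝ)⁻¹ else 0

end MaxChoice

/-! Degrees are compared through non-negative supermartingales. For two vertices of degrees a and b,
let W(a, b) be the value at 1/2 of the Beta(a, b) density, up to a constant. In a Pólya urn W is a
martingale. The max-choice rule favours the larger degree at least as much, so here W is a
supermartingale (`IsMaxChoiceTree.setIntegral_urnDensity_succ_le`). At a tie W(m, m) is at least √m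
/ 4, while W is almost surely bounded, so two given vertices tie only at bounded degrees
(`IsMaxChoiceTree.ae_exists_forall_deg_le`). A newborn facing a vertex of degree a starts from W(a,
1) = a / 2^(a+1), so by the maximal inequality it ever catches up with probability at most 4a /
2^(a+1). With a threshold of about 4 log₂ n for a, Borel–Cantelli leaves only finitely many such
newborns (`IsMaxChoiceTree.ae_eventually_ne`).

Conversely, high degrees do exist: the minimum over l-sets of vertices of the sum of inverse
degrees, multiplied by n^κ with κ = 4^(-d), is also a supermartingale. Hence l vertices have degree
at least of order n^κ, which exceeds the threshold (`IsMaxChoiceTree.ae_eventually_threshold`).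

The rest is deterministic (`Admissible.exists_leaders`). Vertices born late always stay below k
early ones, so the leaders lie in a finite set. Among its members of unbounded degree ties stop, and
a change of order requires a tie, so the order freezes. -/

namespace MaxChoice

/-! ### Degrees in a tree with given attachment choices -/

/-- An attachment sequence is admissible if every new vertex is joined to an existing one. -/
def Admissible (y : ℕ → ℕ) : Prop := ∀ n, 1 ≤ n → y n ∈ Finset.Icc 1 (n + 1)

theorem tree_succ (y : ℕ → ℕ) {n : ℕ} (hn : 1 ≤ n) :
    tree y (n + 1) = tree y n ⊔ SimpleGraph.edge (n + 2) (y n) := by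
  obtain ⟨m, rfl⟩ := Nat.exists_eq_add_of_le' hn
  rfl

theorem Admissible.mem_of_adj {y : ℕ → ℕ} (hy : Admissible y) {n : ℕ} (hn : 1 ≤ n) {i j : ℕ}
    (h : (tree y n).Adj i j) : i ∈ Finset.Icc 1 (n + 1) := by
  induction n, hn using Nat.le_induction generalizing i j with
  | base =>
    simp only [tree, SimpleGraph.edge_adj] at h
    simp only [Finset.mem_Icc]
    omega
  | succ n hn ih =>
    rw [tree_succ y hn, SimpleGraph.sup_adj, SimpleGraph.edge_adj] at h
    have := hy n hn
    simp only [Finset.mem_Icc] at this ⊢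
    rcases h with h | h
    · have := ih h
      simp only [Finset.mem_Icc] at this
      omega
    · omega

theorem Admissible.neighborSet_finite {y : ℕ → ℕ} (hy : Admissible y) {n : ℕ} (hn : 1 ≤ n)
    (i : ℕ) : ((tree y n).neighborSet i).Finite :=
  (Finset.Icc 1 (n + 1)).finite_toSet.subset fun _ hj => hy.mem_of_adj hn (SimpleGraph.Adj.symm hj)

theorem deg_one (y : ℕ → ℕ) (i : ℕ) :
    deg y 1 i = (if i = 2 then 1 else 0) + (if i = 1 then 1 else 0) := by
  have : (tree y 1).neighborSet i = if i = 1 then {2} else if i = 2 then {1} else ∅ := by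
    ext j
    simp only [SimpleGraph.mem_neighborSet, tree, SimpleGraph.edge_adj]
    split_ifs <;> simp <;> omega
  rw [deg, this]
  split_ifs <;> simp_all

theorem Admissible.deg_succ {y : ℕ → ℕ} (hy : Admissible y) {n : ℕ} (hn : 1 ≤ n) (i : ℕ) :
    deg y (n + 1) i =
      deg y n i + ((if i = n + 2 then 1 else 0) + (if i = y n then 1 else 0)) := by
  have hyn := hy n hn
  simp only [Finset.mem_Icc] at hyn
  have key : (tree y (n + 1)).neighborSet i =
      (tree y n).neighborSet i ∪
        (if i = n + 2 then {y n} else if i = y n then {n + 2} else ∅) := by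
    ext j
    simp only [SimpleGraph.mem_neighborSet, tree_succ y hn, SimpleGraph.sup_adj,
      SimpleGraph.edge_adj, Set.mem_union]
    refine or_congr_right ?_
    split_ifs <;> simp <;> omega
  have hfin : (if i = n + 2 then {y n} else if i = y n then {n + 2} else ∅ : Set ℕ).Finite := by
    split_ifs <;> simp
  have hdisj : Disjoint ((tree y n).neighborSet i)
      (if i = n + 2 then {y n} else if i = y n then {n + 2} else ∅) := by
    rw [Set.disjoint_left]
    intro j hj hj'
    have h1 := hy.mem_of_adj hn hj
    have h2 := hy.mem_of_adj hn (SimpleGraph.Adj.symm hj)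
    simp only [Finset.mem_Icc] at h1 h2
    split_ifs at hj' <;> simp at hj' <;> omega
  rw [deg, key, Set.ncard_union_eq hdisj (hy.neighborSet_finite hn i) hfin, deg]
  congr 1
  split_ifs <;> simp <;> omega

theorem Admissible.deg_eq_zero {y : ℕ → ℕ} (hy : Admissible y) {n : ℕ} (hn : 1 ≤ n) {i : ℕ}
    (hi : i ∉ Finset.Icc 1 (n + 1)) : deg y n i = 0 := by
  rw [deg, Set.ncard_eq_zero (hy.neighborSet_finite hn i), Set.eq_empty_iff_forall_notMem]
  exact fun j hj => hi (hy.mem_of_adj hn hj)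

theorem Admissible.one_le_deg {y : ℕ → ℕ} (hy : Admissible y) {n : ℕ} (hn : 1 ≤ n) {i : ℕ}
    (hi : i ∈ Finset.Icc 1 (n + 1)) : 1 ≤ deg y n i := by
  induction n, hn using Nat.le_induction with
  | base =>
    rw [deg_one]
    simp only [Finset.mem_Icc] at hi
    split_ifs <;> omega
  | succ n hn ih =>
    rw [hy.deg_succ hn]
    by_cases h : i = n + 2
    · rw [if_pos h]
      omega
    · have := ih (by simp only [Finset.mem_Icc] at hi ⊢; omega)
      omega

theorem Admissible.mem_of_deg_pos {y : ℕ → ℕ} (hy : Admissible y) {n : ℕ} (hn : 1 ≤ n) {i : ℕ}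
    (hi : 0 < deg y n i) : i ∈ Finset.Icc 1 (n + 1) := by
  by_contra h
  have := hy.deg_eq_zero hn h
  omega

theorem Admissible.sum_deg {y : ℕ → ℕ} (hy : Admissible y) {n : ℕ} (hn : 1 ≤ n) :
    ∑ i ∈ Finset.Icc 1 (n + 1), deg y n i = 2 * n := by
  induction n, hn using Nat.le_induction with
  | base => simp [deg_one, Finset.sum_Icc_succ_top]
  | succ n hn ih =>
    have hyn := hy n hn
    have hyn' : y n ∈ Finset.Icc 1 (n + 1 + 1) := by
      simp only [Finset.mem_Icc] at hyn ⊢; omega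
    simp only [hy.deg_succ hn, Finset.sum_add_distrib, Finset.sum_ite_eq', hyn', if_true]
    rw [Finset.sum_Icc_succ_top (by omega), ih, hy.deg_eq_zero hn (by simp)]
    simp
    omega

theorem Admissible.deg_mono {y : ℕ → ℕ} (hy : Admissible y) {n m : ℕ} (hn : 1 ≤ n) (h : n ≤ m)
    (i : ℕ) : deg y n i ≤ deg y m i := by
  induction m, h using Nat.le_induction with
  | base => rfl
  | succ m hm ih =>
    rw [hy.deg_succ (hn.trans hm)]
    omega

theorem Admissible.deg_newborn {y : ℕ → ℕ} (hy : Admissible y) {n : ℕ} (hn : 1 ≤ n) :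
    deg y (n + 1) (n + 2) = 1 := by
  have hyn := hy n hn
  simp only [Finset.mem_Icc] at hyn
  rw [hy.deg_succ hn, hy.deg_eq_zero hn (by simp), if_pos rfl, if_neg (by omega)]

/-- A vertex cannot overtake another one without having the same degree at some time. -/
theorem Admissible.deg_lt_of_ne {y : ℕ → ℕ} (hy : Admissible y) {n : ℕ} (hn : 1 ≤ n) {i j : ℕ}
    (h0 : deg y n i < deg y n j) (hi : i ≤ n + 1) (hne : ∀ m, n ≤ m → deg y m j ≠ deg y m i)
    {m : ℕ} (hm : n ≤ m) : deg y m i < deg y m j := by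
  induction m, hm using Nat.le_induction with
  | base => exact h0
  | succ m hm ih =>
    have h1 := hne (m + 1) (by omega)
    rw [hy.deg_succ (hn.trans hm), hy.deg_succ (hn.trans hm)] at *
    rw [if_neg (show i ≠ m + 2 by omega)] at *
    have : (if i = y m then 1 else 0 : ℕ) ≤ 1 := by split_ifs <;> omega
    omega

/-- Countability of the attainable trees is what makes every property of P_n, however wild, an
event. -/
theorem countable_range_tree (n : ℕ) : (Set.range fun y => tree y n).Countable := by
  induction n with
  | zero => simp [tree]
  | succ n ih =>
    rcases Nat.eq_zero_or_pos n with rfl | hn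
    · simp [tree]
    · refine ((ih.prod (Set.countable_univ (α := ℕ))).image
        fun p => p.1 ⊔ SimpleGraph.edge (n + 2) p.2).mono ?_
      rintro _ ⟨y, rfl⟩
      exact ⟨(tree y n, y n), ⟨⟨y, rfl⟩, trivial⟩, (tree_succ y hn).symm⟩

/-- Finiteness makes every real function of P_n bounded, hence integrable. -/
theorem finite_tree_of_admissible {n : ℕ} (hn : 1 ≤ n) :
    ((fun y => tree y n) '' {y | Admissible y}).Finite := by
  induction n, hn using Nat.le_induction with
  | base => exact (Set.finite_singleton (SimpleGraph.edge 1 2)).subset (by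
      rintro _ ⟨y, -, rfl⟩; rfl)
  | succ n hn ih =>
    refine ((ih.prod (Finset.Icc 1 (n + 1)).finite_toSet).image
        fun p => p.1 ⊔ SimpleGraph.edge (n + 2) p.2).subset ?_
    rintro _ ⟨y, hy, rfl⟩
    exact ⟨(tree y n, y n), ⟨⟨y, hy, rfl⟩, hy n hn⟩, (tree_succ y hn).symm⟩

/-! ### Measurability and integrability of functions of the tree -/

section Measurability

variable {Ω : Type*} {Y : ℕ → Ω → ℕ}

theorem history_mono (Y : ℕ → Ω → ℕ) : Monotone (history Y) := fun _ _ hnm =>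
  biSup_mono fun _ hi => Finset.Icc_subset_Icc_right hnm hi

theorem measurableSet_history_tree {n : ℕ} (hn : 1 ≤ n) (S : Set (SimpleGraph ℕ)) :
    MeasurableSet[history Y n] {ω | tree (fun i => Y i ω) n ∈ S} := by
  have hle : MeasurableSpace.comap (fun ω => (tree (fun i => Y i ω) n).edgeSet) inferInstance ≤
      history Y n :=
    le_iSup₂_of_le (f := fun m (_ : m ∈ Finset.Icc 1 n) =>
      MeasurableSpace.comap (fun ω => (tree (fun i => Y i ω) m).edgeSet) inferInstance)
      n (by simp [hn]) le_rfl
  -- Intersecting with the attainable trees makes the witness countable, hence measurable.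
  refine hle _ ⟨SimpleGraph.edgeSet '' (S ∩ Set.range fun y => tree y n), ?_, ?_⟩
  · exact ((countable_range_tree n).mono Set.inter_subset_right).image _ |>.measurableSet
  · ext ω
    simp only [Set.mem_preimage, Set.mem_image, Set.mem_ofPred_eq]
    constructor
    · rintro ⟨t, ht, h⟩
      rw [← SimpleGraph.edgeSet_injective h]
      exact ht.1
    · exact fun h => ⟨_, ⟨h, fun i => Y i ω, rfl⟩, rfl⟩

theorem measurable_history_tree {β : Type*} [MeasurableSpace β] {n : ℕ} (hn : 1 ≤ n)
    (g : SimpleGraph ℕ → β) : Measurable[history Y n] fun ω => g (tree (fun i => Y i ω) n) :=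
  fun S _ => measurableSet_history_tree hn (g ⁻¹' S)

variable [MeasurableSpace Ω]

theorem measurableSet_tree (hY : ∀ n, 1 ≤ n → Measurable (Y n)) {n : ℕ} (hn : 1 ≤ n)
    (S : Set (SimpleGraph ℕ)) : MeasurableSet {ω | tree (fun i => Y i ω) n ∈ S} := by
  induction n, hn using Nat.le_induction generalizing S with
  | base => exact MeasurableSet.const (tree (fun _ => 0) 1 ∈ S)
  | succ n hn ih =>
    have : {ω | tree (fun i => Y i ω) (n + 1) ∈ S} = ⋃ k, (Y n ⁻¹' {k} ∩
        {ω | tree (fun i => Y i ω) n ∈ {t | t ⊔ SimpleGraph.edge (n + 2) k ∈ S}}) := by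
      ext ω
      simp [tree_succ _ hn]
    rw [this]
    exact MeasurableSet.iUnion fun k => (hY n hn (measurableSet_singleton k)).inter (ih _)

theorem history_le (hY : ∀ n, 1 ≤ n → Measurable (Y n)) (n : ℕ) :
    history Y n ≤ ‹MeasurableSpace Ω› := by
  refine iSup₂_le fun m hm => ?_
  rintro _ ⟨S, -, rfl⟩
  exact measurableSet_tree hY (Finset.mem_Icc.1 hm).1 (SimpleGraph.edgeSet ⁻¹' S)

theorem measurable_tree {β : Type*} [MeasurableSpace β] (hY : ∀ n, 1 ≤ n → Measurable (Y n))
    {n : ℕ} (hn : 1 ≤ n) (g : SimpleGraph ℕ → β) :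
    Measurable fun ω => g (tree (fun i => Y i ω) n) :=
  fun S _ => measurableSet_tree hY hn (g ⁻¹' S)

theorem integrable_tree {μ : Measure Ω} [IsFiniteMeasure μ] (hY : ∀ n, 1 ≤ n → Measurable (Y n))
    (hadm : ∀ ω, Admissible fun i => Y i ω) {n : ℕ} (hn : 1 ≤ n) (g : SimpleGraph ℕ → ℝ) :
    Integrable (fun ω => g (tree (fun i => Y i ω) n)) μ := by
  obtain ⟨C, hC⟩ := ((finite_tree_of_admissible hn).image fun t => ‖g t‖).bddAbove
  refine Integrable.of_bound (measurable_tree hY hn g).aestronglyMeasurable C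
    (Filter.Eventually.of_forall fun ω => hC ⟨_, ⟨_, hadm ω, rfl⟩, rfl⟩)

end Measurability

/-! ### One-step conditional expectations -/

section OneStep

variable {Ω : Type*} [MeasurableSpace Ω] {μ : Measure Ω} {d : ℕ} {X : ℕ → Fin d → Ω → ℕ}
  {Y : ℕ → Ω → ℕ}

theorem IsMaxChoiceTree.admissible (h : IsMaxChoiceTree μ d X Y) (ω : Ω) :
    Admissible fun i => Y i ω := by
  intro n hn
  have := h.Y_mem n hn ω
  simp only [winners, Finset.mem_filter, Finset.mem_image, Finset.mem_univ, true_and] at this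
  obtain ⟨⟨j, hj⟩, -⟩ := this
  change Y n ω ∈ _
  exact hj ▸ h.X_mem n hn j ω

theorem IsMaxChoiceTree.measurableSet_sample (h : IsMaxChoiceTree μ d X Y) {n : ℕ} (hn : 1 ≤ n)
    (x : Fin d → ℕ) : MeasurableSet {ω | ∀ j, X n j ω = x j} := by
  rw [Set.ofPred_forall]
  exact MeasurableSet.iInter fun j => h.measurable_X n hn j (measurableSet_singleton _)

variable [IsProbabilityMeasure μ]

/-- The factor depending on P_n is bounded and known at time n, so it can be pulled out of the
conditional expectation, leaving the sampling law. -/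
theorem IsMaxChoiceTree.setIntegral_indicator (h : IsMaxChoiceTree μ d X Y) {n : ℕ} (hn : 1 ≤ n)
    (g : SimpleGraph ℕ → ℝ) (x : Fin d → ℕ) {B : Set Ω} (hB : MeasurableSet[history Y n] B) :
    ∫ ω in B, g (tree (fun i => Y i ω) n) *
        {ω | ∀ j, X n j ω = x j}.indicator (fun _ => (1 : ℝ)) ω ∂μ =
      ∫ ω in B, g (tree (fun i => Y i ω) n) *
        ∏ j, (deg (fun i => Y i ω) n (x j) : ℝ) / (2 * n) ∂μ := by
  have hle := history_le h.measurable_Y n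
  have hS := h.measurableSet_sample hn x
  have hI : Integrable ({ω | ∀ j, X n j ω = x j}.indicator fun _ => (1 : ℝ)) μ :=
    (integrable_const 1).indicator hS
  have hg : StronglyMeasurable[history Y n] fun ω => g (tree (fun i => Y i ω) n) :=
    (measurable_history_tree hn g).stronglyMeasurable
  obtain ⟨C, hC⟩ := ((finite_tree_of_admissible hn).image fun t => ‖g t‖).bddAbove
  have hC' : ∀ ω, ‖g (tree (fun i => Y i ω) n)‖ ≤ C := fun ω =>
    hC ⟨_, ⟨_, h.admissible ω, rfl⟩, rfl⟩
  have hgI : Integrable ((fun ω => g (tree (fun i => Y i ω) n)) *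
      {ω | ∀ j, X n j ω = x j}.indicator fun _ => (1 : ℝ)) μ :=
    hI.bdd_mul (hg.mono hle).aestronglyMeasurable (Filter.Eventually.of_forall hC')
  calc _ = ∫ ω in B, μ[(fun ω => g (tree (fun i => Y i ω) n)) *
            {ω | ∀ j, X n j ω = x j}.indicator (fun _ => (1 : ℝ)) | history Y n] ω ∂μ :=
        (setIntegral_condExp hle hgI hB).symm
    _ = _ := by
        refine setIntegral_congr_ae (hle _ hB) ?_
        filter_upwards [condExp_mul_of_stronglyMeasurable_left hg hgI hI, h.X_law n hn x]
          with ω h1 h2 _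
        rw [h1, Pi.mul_apply, h2]

/-- A one-step bound in terms of the sampled vertices gives a supermartingale inequality. -/
theorem IsMaxChoiceTree.setIntegral_succ_le (h : IsMaxChoiceTree μ d X Y) {n : ℕ} (hn : 1 ≤ n)
    (z z' : SimpleGraph ℕ → ℝ) (H : SimpleGraph ℕ → (Fin d → ℕ) → ℝ)
    (hz' : ∀ ω, z' (tree (fun i => Y i ω) (n + 1)) ≤
      H (tree (fun i => Y i ω) n) fun j => X n j ω)
    (hz : ∀ ω, ∑ x ∈ Fintype.piFinset fun _ : Fin d => Finset.Icc 1 (n + 1),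
      H (tree (fun i => Y i ω) n) x * ∏ j, (deg (fun i => Y i ω) n (x j) : ℝ) / (2 * n) ≤
        z (tree (fun i => Y i ω) n))
    {B : Set Ω} (hB : MeasurableSet[history Y n] B) :
    ∫ ω in B, z' (tree (fun i => Y i ω) (n + 1)) ∂μ ≤ ∫ ω in B, z (tree (fun i => Y i ω) n) ∂μ := by
  have hadm := h.admissible
  have hint := fun (g : SimpleGraph ℕ → ℝ) =>
    (integrable_tree (μ := μ) h.measurable_Y hadm hn g).integrableOn (s := B)
  have hS := h.measurableSet_sample hn
  have hint1 : ∀ x, IntegrableOn (fun ω => H (tree (fun i => Y i ω) n) x *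
      {ω | ∀ j, X n j ω = x j}.indicator (fun _ => (1 : ℝ)) ω) B μ := fun x => by
    refine Integrable.mul_bdd (c := 1) (hint fun t => H t x)
      ((measurable_const.indicator (hS x)).aestronglyMeasurable)
      (Filter.Eventually.of_forall fun ω => ?_)
    by_cases hω : ω ∈ {ω | ∀ j, X n j ω = x j} <;> simp only [Set.indicator, hω] <;> simp
  have hint2 : ∀ x : Fin d → ℕ, IntegrableOn (fun ω => H (tree (fun i => Y i ω) n) x *
      ∏ j, (deg (fun i => Y i ω) n (x j) : ℝ) / (2 * n)) B μ := fun x =>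
    hint fun t => H t x * ∏ j, ((t.neighborSet (x j)).ncard : ℝ) / (2 * n)
  -- Splitting over the finitely many possible sample vectors reduces the expectation to the
  -- conditional law of the samples.
  have hsum : ∀ ω, H (tree (fun i => Y i ω) n) (fun j => X n j ω) =
      ∑ x ∈ Fintype.piFinset fun _ : Fin d => Finset.Icc 1 (n + 1),
        H (tree (fun i => Y i ω) n) x *
          {ω | ∀ j, X n j ω = x j}.indicator (fun _ => (1 : ℝ)) ω := by
    intro ω
    rw [Finset.sum_eq_single_of_mem (fun j => X n j ω)]
    · simp
    · exact Fintype.mem_piFinset.2 fun j => h.X_mem n hn j ω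
    · intro x _ hx
      rw [Set.indicator_of_notMem, mul_zero]
      exact fun hω => hx (funext fun j => (hω j).symm)
  calc _ ≤ ∫ ω in B, ∑ x ∈ Fintype.piFinset fun _ : Fin d => Finset.Icc 1 (n + 1),
        H (tree (fun i => Y i ω) n) x *
          {ω | ∀ j, X n j ω = x j}.indicator (fun _ => (1 : ℝ)) ω ∂μ :=
        setIntegral_mono
          (integrable_tree h.measurable_Y hadm (by omega) z').integrableOn
          (integrable_finsetSum _ fun x _ => hint1 x) fun ω => (hz' ω).trans (hsum ω).le
    _ = ∫ ω in B, ∑ x ∈ Fintype.piFinset fun _ : Fin d => Finset.Icc 1 (n + 1),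
        H (tree (fun i => Y i ω) n) x *
          ∏ j, (deg (fun i => Y i ω) n (x j) : ℝ) / (2 * n) ∂μ := by
        rw [integral_finsetSum _ fun x _ => hint1 x, integral_finsetSum _ fun x _ => hint2 x]
        exact Finset.sum_congr rfl fun x _ => h.setIntegral_indicator hn (fun t => H t x) x hB
    _ ≤ _ := setIntegral_mono (integrable_finsetSum _ fun x _ => hint2 x) (hint z) hz

end OneStep

/-! ### Maximal inequality for non-negative supermartingales -/

section Maximal

variable {Ω : Type*} [m0 : MeasurableSpace Ω] {μ : Measure Ω} [IsFiniteMeasure μ]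
  {F : ℕ → MeasurableSpace Ω} {Z : ℕ → Ω → ℝ}

/-- The maximal inequality for non-negative supermartingales. -/
theorem mul_measureReal_exists_le (hF : Monotone F) (hle : ∀ n, F n ≤ m0)
    (hnn : ∀ n ω, 0 ≤ Z n ω) (hm : ∀ n, Measurable[F n] (Z n)) (hi : ∀ n, Integrable (Z n) μ)
    (hs : ∀ n B, MeasurableSet[F n] B → ∫ ω in B, Z (n + 1) ω ∂μ ≤ ∫ ω in B, Z n ω ∂μ)
    {B : Set Ω} (hB : MeasurableSet[F 0] B) (c : ℝ) :
    c * μ.real (B ∩ {ω | ∃ n, c ≤ Z n ω}) ≤ ∫ ω in B, Z 0 ω ∂μ := by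
  -- `A n` is the part of `B` on which Z stays below c up to time n. Splitting off each first
  -- passage above c gives the estimate `key`.
  set A : ℕ → Set Ω := fun n => Nat.rec (B ∩ {ω | Z 0 ω < c})
    (fun n A => A ∩ {ω | Z (n + 1) ω < c}) n with hA
  have hA0 : A 0 = B ∩ {ω | Z 0 ω < c} := rfl
  have hAs : ∀ n, A (n + 1) = A n ∩ {ω | Z (n + 1) ω < c} := fun n => rfl
  clear_value A
  have hlt : ∀ n, MeasurableSet[F n] {ω | Z n ω < c} := fun n =>
    hm n (measurableSet_Iio (a := c))
  have hAm : ∀ n, MeasurableSet[F n] (A n) := by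
    intro n
    induction n with
    | zero => rw [hA0]; exact MeasurableSet.inter hB (hlt 0)
    | succ n ih =>
      rw [hAs]
      exact MeasurableSet.inter (hF n.le_succ _ ih) (hlt _)
  have hAm' : ∀ n, MeasurableSet (A n) := fun n => hle n _ (hAm n)
  have hB' : MeasurableSet B := hle 0 _ hB
  have hAB : ∀ n, A n ⊆ B := by
    intro n
    induction n with
    | zero => rw [hA0]; exact Set.inter_subset_left
    | succ n ih => rw [hAs]; exact Set.inter_subset_left.trans ih
  have hdec : ∀ n {E E' : Set Ω}, MeasurableSet E → MeasurableSet E' → E' ⊆ E →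
      (∀ ω ∈ E \ E', c ≤ Z n ω) →
      ∫ ω in E', Z n ω ∂μ + c * μ.real (E \ E') ≤ ∫ ω in E, Z n ω ∂μ := by
    intro n E E' hE hE' hsub h
    rw [← integral_inter_add_sdiff (s := E) hE' (hi n).integrableOn,
      Set.inter_eq_right.2 hsub]
    gcongr
    calc c * μ.real (E \ E') = ∫ _ in E \ E', c ∂μ := by
          rw [setIntegral_const, smul_eq_mul, mul_comm]
      _ ≤ _ := setIntegral_mono_on (integrable_const _).integrableOn (hi n).integrableOn
          (hE.diff hE') h
  have key : ∀ n, ∫ ω in A n, Z n ω ∂μ + c * μ.real (B \ A n) ≤ ∫ ω in B, Z 0 ω ∂μ := by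
    intro n
    induction n with
    | zero =>
      refine hdec 0 hB' (hAm' 0) (hAB 0) fun ω hω => ?_
      rw [hA0] at hω
      exact not_lt.1 fun h => hω.2 ⟨hω.1, h⟩
    | succ n ih =>
      have hsub : A (n + 1) ⊆ A n := by rw [hAs]; exact Set.inter_subset_left
      have h1 := hdec (n + 1) (hAm' n) (hAm' (n + 1)) hsub fun ω hω => by
        rw [hAs] at hω
        exact not_lt.1 fun h => hω.2 ⟨hω.1, h⟩
      have h2 := hs n _ (hAm n)
      have h3 : μ.real (B \ A (n + 1)) = μ.real (B \ A n) + μ.real (A n \ A (n + 1)) := by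
        rw [← measureReal_union (Set.disjoint_left.2 fun ω h h' => h.2 h'.1)
          ((hAm' n).diff (hAm' (n + 1)))]
        congr 1
        ext ω
        have := @hsub ω
        have := @hAB n ω
        simp only [Set.mem_union, Set.mem_sdiff]
        tauto
      rw [h3]
      linarith
  have hU : B ∩ {ω | ∃ n, c ≤ Z n ω} = ⋃ n, B \ A n := by
    have hmem : ∀ n ω, ω ∈ A n ↔ ω ∈ B ∧ ∀ m, m ≤ n → Z m ω < c := by
      intro n ω
      induction n with
      | zero => rw [hA0]; simp
      | succ n ih =>
        rw [hAs, Set.mem_inter_iff, ih, and_assoc]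
        simp only [Set.mem_ofPred_eq, Nat.le_succ_iff, or_imp, forall_and, forall_eq]
    ext ω
    simp only [Set.mem_inter_iff, Set.mem_ofPred_eq, Set.mem_iUnion, Set.mem_sdiff, hmem]
    constructor
    · rintro ⟨h1, n, hn⟩
      exact ⟨n, h1, fun h => not_lt.2 hn (h.2 n le_rfl)⟩
    · rintro ⟨n, h1, h2⟩
      refine ⟨h1, ?_⟩
      by_contra! h
      exact h2 ⟨h1, fun m _ => h m⟩
  have hanti : Antitone A := antitone_nat_of_succ_le fun n => by
    rw [hAs]; exact Set.inter_subset_left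
  have hlim := tendsto_measure_iUnion_atTop (μ := μ) (s := fun n => B \ A n)
    fun _ _ h => Set.sdiff_subset_sdiff_right (hanti h)
  rw [← hU] at hlim
  have hlim' := ((ENNReal.tendsto_toReal (measure_ne_top μ _)).comp hlim).const_mul c
  refine le_of_tendsto' hlim' fun n => ?_
  have := key n
  have h0 : 0 ≤ ∫ ω in A n, Z n ω ∂μ := integral_nonneg fun ω => hnn n ω
  change c * μ.real (B \ A n) ≤ _
  linarith

/-- A non-negative supermartingale is almost surely bounded. -/
theorem ae_exists_forall_le (hF : Monotone F) (hle : ∀ n, F n ≤ m0)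
    (hnn : ∀ n ω, 0 ≤ Z n ω) (hm : ∀ n, Measurable[F n] (Z n)) (hi : ∀ n, Integrable (Z n) μ)
    (hs : ∀ n B, MeasurableSet[F n] B → ∫ ω in B, Z (n + 1) ω ∂μ ≤ ∫ ω in B, Z n ω ∂μ) :
    ∀ᵐ ω ∂μ, ∃ C, ∀ n, Z n ω ≤ C := by
  rw [ae_iff]
  set N : Set Ω := {ω | ¬∃ C, ∀ n, Z n ω ≤ C}
  have h : ∀ k : ℕ, (k : ℝ) * μ.real N ≤ ∫ ω, Z 0 ω ∂μ := by
    intro k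
    have := mul_measureReal_exists_le (μ := μ) hF hle hnn hm hi hs MeasurableSet.univ k
    rw [Set.univ_inter, setIntegral_univ] at this
    refine le_trans ?_ this
    refine mul_le_mul_of_nonneg_left (measureReal_mono ?_) (Nat.cast_nonneg k)
    intro ω hω
    by_contra hcon
    simp only [Set.mem_ofPred_eq, not_exists, not_le] at hcon
    exact hω ⟨k, fun n => (hcon n).le⟩
  have h0 : μ.real N = 0 := by
    by_contra hne
    have hpos : 0 < μ.real N := lt_of_le_of_ne measureReal_nonneg (Ne.symm hne)
    obtain ⟨k, hk⟩ := exists_nat_gt ((∫ ω, Z 0 ω ∂μ) / μ.real N)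
    rw [div_lt_iff₀ hpos] at hk
    exact absurd (h k) (not_le.2 hk)
  exact (measureReal_eq_zero_iff).1 h0

end Maximal

/-! ### Probabilities for independent samples -/

section Sampling

variable {d : ℕ}

theorem sum_piFinset_prod_eq_one {V : Finset ℕ} {p : ℕ → ℝ} (hp : ∑ i ∈ V, p i = 1) :
    ∑ x ∈ Fintype.piFinset fun _ : Fin d => V, ∏ j, p (x j) = 1 := by
  rw [← Finset.prod_univ_sum (fun _ : Fin d => V) fun _ => p]
  simp [hp]

/-- The probability that the `j`-th sample is `u` and all the others satisfy `q`. -/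
theorem sum_piFinset_ite_mul_prod {V : Finset ℕ} (p : ℕ → ℝ) (j : Fin d) {u : ℕ} (hu : u ∈ V)
    (q : ℕ → Prop) [DecidablePred q] :
    ∑ x ∈ Fintype.piFinset fun _ : Fin d => V,
      (if x j = u ∧ ∀ i, i ≠ j → q (x i) then (1 : ℝ) else 0) * ∏ i, p (x i) =
      p u * (∑ i ∈ V with q i, p i) ^ (d - 1) := by
  have h : ∀ x : Fin d → ℕ,
      (if x j = u ∧ ∀ i, i ≠ j → q (x i) then (1 : ℝ) else 0) * ∏ i, p (x i) =
      ∏ i, (if i = j then (if x i = u then p (x i) else 0) else if q (x i) then p (x i) else 0) := by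
    intro x
    split_ifs with hx
    · rw [one_mul]
      refine Finset.prod_congr rfl fun i _ => ?_
      by_cases hi : i = j
      · subst hi; simp [hx.1]
      · simp [hi, hx.2 i hi]
    · rw [zero_mul, eq_comm, Finset.prod_eq_zero_iff]
      rw [not_and_or] at hx
      rcases hx with hx | hx
      · exact ⟨j, Finset.mem_univ _, by simp [hx]⟩
      · push Not at hx
        obtain ⟨i, hi, hq⟩ := hx
        exact ⟨i, Finset.mem_univ _, by simp [hi, hq]⟩
  simp only [h]
  rw [← Finset.prod_univ_sum (fun _ : Fin d => V) fun (i : Fin d) k =>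
    (if i = j then (if k = u then p k else 0) else if q k then p k else 0),
    ← Finset.mul_prod_erase _ _ (Finset.mem_univ j)]
  congr 1
  · simp [hu]
  · rw [Finset.prod_congr rfl (g := fun _ => ∑ i ∈ V with q i, p i), Finset.prod_const,
      Finset.card_erase_of_mem (Finset.mem_univ j), Finset.card_univ, Fintype.card_fin]
    intro i hi
    simp only [if_neg (Finset.ne_of_mem_erase hi), Finset.sum_filter]

end Sampling

/-! ### The urn density -/

/-- The density at `1/2` of the beta distribution with parameters `a` and `b`, up to a constant
factor. In a Pólya urn with `a` and `b` balls of the two colours it is a martingale. -/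
noncomputable def urnDensity (a b : ℕ) : ℝ :=
  ((a + b - 1).factorial : ℝ) / ((a - 1).factorial * (b - 1).factorial * 2 ^ (a + b))

theorem urnDensity_comm (a b : ℕ) : urnDensity a b = urnDensity b a := by
  rw [urnDensity, urnDensity, add_comm a b, mul_comm ((a - 1).factorial : ℝ)]

theorem urnDensity_pos (a b : ℕ) : 0 < urnDensity a b := by
  rw [urnDensity]
  positivity

theorem urnDensity_succ_left {a b : ℕ} (ha : 1 ≤ a) (hb : 1 ≤ b) :
    urnDensity (a + 1) b = urnDensity a b * ((a + b) / (2 * a)) := by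
  obtain ⟨a, rfl⟩ := Nat.exists_eq_add_of_le' ha
  obtain ⟨b, rfl⟩ := Nat.exists_eq_add_of_le' hb
  simp only [urnDensity, show a + 1 + 1 + (b + 1) - 1 = a + b + 1 + 1 by omega,
    show a + 1 + (b + 1) - 1 = a + b + 1 by omega, Nat.add_sub_cancel, Nat.factorial_succ]
  push_cast
  field_simp
  ring

theorem urnDensity_succ_right {a b : ℕ} (ha : 1 ≤ a) (hb : 1 ≤ b) :
    urnDensity a (b + 1) = urnDensity a b * ((a + b) / (2 * b)) := by
  rw [urnDensity_comm, urnDensity_succ_left hb ha, urnDensity_comm, add_comm (b : ℝ)]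

theorem urnDensity_one_right {a : ℕ} (ha : 1 ≤ a) : urnDensity a 1 = a / 2 ^ (a + 1) := by
  obtain ⟨a, rfl⟩ := Nat.exists_eq_add_of_le' ha
  simp only [urnDensity, Nat.add_sub_cancel, Nat.factorial_succ, Nat.sub_self, Nat.factorial_zero]
  push_cast
  field_simp

/-- Passing from m to m + 1 multiplies the square by ((2m + 1) / (2m))² = 1 + 1/m + 1/(4m²), which
exceeds (m + 1)/m; equality holds at m = 1. -/
theorem urnDensity_self_sq_ge {m : ℕ} (hm : 1 ≤ m) : (m : ℝ) / 16 ≤ urnDensity m m ^ 2 := by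
  induction m, hm using Nat.le_induction with
  | base => rw [urnDensity_one_right le_rfl]; norm_num
  | succ m hm ih =>
    rw [urnDensity_succ_left hm (by omega), urnDensity_succ_right hm hm, mul_assoc, mul_pow]
    have hm' : (1 : ℝ) ≤ m := by exact_mod_cast hm
    have h : ((m : ℝ) + 1) / m ≤
        (((m : ℝ) + m) / (2 * m) * ((m + (m + 1 : ℕ)) / (2 * m))) ^ 2 := by
      push_cast
      rw [show ((m : ℝ) + m) / (2 * m) = 1 by field_simp; ring, one_mul, div_pow,
        div_le_div_iff₀ (by positivity) (by positivity)]
      nlinarith [mul_nonneg (show (0 : ℝ) ≤ m by linarith) (show (0 : ℝ) ≤ m by linarith)]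
    calc ((m + 1 : ℕ) : ℝ) / 16 = m / 16 * ((m + 1) / m) := by push_cast; field_simp
      _ ≤ _ := by gcongr

theorem urnDensity_self_ge {m : ℕ} (hm : 1 ≤ m) : 1 / 4 ≤ urnDensity m m := by
  have h := urnDensity_self_sq_ge hm
  have hm' : (1 : ℝ) ≤ m := by exact_mod_cast hm
  have := urnDensity_pos m m
  nlinarith

/-! ### The urn density of two vertices decreases in mean -/

section Pair

variable {d : ℕ}

/-- A sampled vertex strictly above all other samples wins whatever the tie-breaking. Strictness
makes the events for different indices `j` disjoint, so the sum is at most 1. -/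
theorem sum_ite_le_ite {D : ℕ → ℕ} {x : Fin d → ℕ} {u y : ℕ} (hy : ∃ j, x j = y)
    (hmax : ∀ j, D (x j) ≤ D y) :
    ∑ j, (if x j = u ∧ ∀ i, i ≠ j → D (x i) < D u then (1 : ℝ) else 0) ≤
      if y = u then 1 else 0 := by
  by_cases h : ∃ j, x j = u ∧ ∀ i, i ≠ j → D (x i) < D u
  · obtain ⟨j, hj, hlt⟩ := h
    have hyu : y = u := by
      obtain ⟨i, rfl⟩ := hy
      by_contra hne
      have hij : i ≠ j := fun h => hne (h ▸ hj)
      have h1 := hmax j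
      have h2 := hlt i hij
      rw [hj] at h1
      omega
    rw [if_pos hyu, Finset.sum_eq_single j]
    · split_ifs <;> norm_num
    · intro i _ hij
      rw [if_neg]
      rintro ⟨hi, -⟩
      have := hlt i hij
      rw [hi] at this
      omega
    · simp
  · push Not at h
    rw [Finset.sum_eq_zero]
    · split_ifs <;> norm_num
    · intro j _
      rw [if_neg]
      rintro ⟨hj, hlt⟩
      obtain ⟨i, hi, hle⟩ := h j hj
      exact absurd (hlt i hi) (not_lt.2 hle)

/-- Union bound over the index at which the winner was sampled; a winner has no sample above it. -/
theorem ite_le_sum_ite {D : ℕ → ℕ} {x : Fin d → ℕ} {v y : ℕ} (hy : ∃ j, x j = y)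
    (hmax : ∀ j, D (x j) ≤ D y) :
    (if y = v then 1 else 0) ≤
      ∑ j, (if x j = v ∧ ∀ i, i ≠ j → D (x i) ≤ D v then (1 : ℝ) else 0) := by
  have h0 : ∀ j ∈ Finset.univ,
      (0 : ℝ) ≤ if x j = v ∧ ∀ i, i ≠ j → D (x i) ≤ D v then (1 : ℝ) else 0 := by
    intro j _
    split_ifs <;> norm_num
  split_ifs with hyv
  · obtain ⟨j, hj⟩ := hy
    refine le_trans ?_ (Finset.single_le_sum h0 (Finset.mem_univ j))
    rw [if_pos ⟨hj.trans hyv, fun i _ => hyv ▸ hmax i⟩]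
  · exact Finset.sum_nonneg h0

/-- An upper bound for the urn density of the degrees of `u` and `v` after one more step, in terms
of the degrees `D` and the samples `x`, provided that the degree of `u` is not smaller than that
of `v`. -/
noncomputable def urnBound (u v : ℕ) (D : ℕ → ℕ) (x : Fin d → ℕ) : ℝ :=
  urnDensity (D u) (D v) * (1 + ((D u : ℝ) - D v) / 2 *
    ((∑ j, if x j = v ∧ ∀ i, i ≠ j → D (x i) ≤ D v then (1 : ℝ) else 0) / D v -
      (∑ j, if x j = u ∧ ∀ i, i ≠ j → D (x i) < D u then (1 : ℝ) else 0) / D u))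

theorem urnDensity_le_urnBound {D : ℕ → ℕ} {x : Fin d → ℕ} {u v y : ℕ} (huv : u ≠ v)
    (hv : 1 ≤ D v) (hvu : D v ≤ D u) (hy : ∃ j, x j = y) (hmax : ∀ j, D (x j) ≤ D y) :
    urnDensity (D u + if u = y then 1 else 0) (D v + if v = y then 1 else 0) ≤
      urnBound u v D x := by
  have hA : (0 : ℝ) < D u := by exact_mod_cast (by omega : 0 < D u)
  have hB : (0 : ℝ) < D v := by exact_mod_cast (by omega : 0 < D v)
  have hAB : (0 : ℝ) ≤ (D u : ℝ) - D v := sub_nonneg.2 (by exact_mod_cast hvu)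
  -- Exact increment: a step to u multiplies the density by 1 - (A - B)/(2A), a step to v by 1 + (A
  -- - B)/(2B). As A ≥ B, bounding the two indicators then gives an upper bound.
  have key : urnDensity (D u + if u = y then 1 else 0) (D v + if v = y then 1 else 0) =
      urnDensity (D u) (D v) * (1 + ((D u : ℝ) - D v) / 2 *
        ((if y = v then 1 else 0) / D v - (if y = u then 1 else 0) / D u)) := by
    by_cases h1 : y = u
    · have h2 : y ≠ v := h1 ▸ huv
      rw [if_pos h1.symm, if_neg h2.symm, if_neg h2, if_pos h1, add_zero,
        urnDensity_succ_left (hv.trans hvu) hv]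
      field_simp
      ring
    · by_cases h2 : y = v
      · rw [if_neg (Ne.symm h1), if_pos h2.symm, if_pos h2, if_neg h1, add_zero,
          urnDensity_succ_right (hv.trans hvu) hv]
        field_simp
        ring
      · simp [h1, h2, Ne.symm h1, Ne.symm h2]
  rw [key, urnBound]
  have := urnDensity_pos (D u) (D v)
  gcongr
  · exact ite_le_sum_ite hy hmax
  · exact sum_ite_le_ite hy hmax

/-- After division by the degrees, the bounds for choosing v and u become d/s · FB^(d-1) and d/s ·
FA^(d-1). If D v < D u, a degree at most D v is below D u, so FB ≤ FA; if the degrees agree, the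
prefactor vanishes. -/
theorem sum_urnBound_le {V : Finset ℕ} {D : ℕ → ℕ} {u v : ℕ} (hu : u ∈ V)
    (hv : v ∈ V) (hv1 : 1 ≤ D v) (hvu : D v ≤ D u) {s : ℝ} (hs : 0 < s)
    (hp : ∑ i ∈ V, (D i : ℝ) / s = 1) :
    ∑ x ∈ Fintype.piFinset fun _ : Fin d => V, urnBound u v D x * ∏ j, (D (x j) : ℝ) / s ≤
      urnDensity (D u) (D v) := by
  have hA : (0 : ℝ) < D u := by exact_mod_cast (by omega : 0 < D u)
  have hB : (0 : ℝ) < D v := by exact_mod_cast (by omega : 0 < D v)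
  have hAB : (0 : ℝ) ≤ (D u : ℝ) - D v := sub_nonneg.2 (by exact_mod_cast hvu)
  set P : (Fin d → ℕ) → ℝ := fun x => ∏ j, (D (x j) : ℝ) / s with hP
  set FB : ℝ := ∑ i ∈ V with D i ≤ D v, (D i : ℝ) / s with hFB
  set FA : ℝ := ∑ i ∈ V with D i < D u, (D i : ℝ) / s with hFA
  have h1 : ∑ x ∈ Fintype.piFinset fun _ : Fin d => V, P x = 1 :=
    sum_piFinset_prod_eq_one (p := fun i => (D i : ℝ) / s) hp
  have h2 := fun j : Fin d => sum_piFinset_ite_mul_prod (fun i => (D i : ℝ) / s) j hv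
    fun i => D i ≤ D v
  have h3 := fun j : Fin d => sum_piFinset_ite_mul_prod (fun i => (D i : ℝ) / s) j hu
    fun i => D i < D u
  have hE : ∑ x ∈ Fintype.piFinset fun _ : Fin d => V, urnBound u v D x * P x =
      urnDensity (D u) (D v) * (1 + ((D u : ℝ) - D v) / 2 *
        ((∑ _j : Fin d, D v / s * FB ^ (d - 1)) / D v -
          (∑ _j : Fin d, D u / s * FA ^ (d - 1)) / D u)) := by
    simp only [hFB, hFA]
    rw [← Finset.sum_congr rfl fun j _ => h2 j, ← Finset.sum_congr rfl fun j _ => h3 j,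
      Finset.sum_comm, Finset.sum_comm (s := (Finset.univ : Finset (Fin d)))]
    have hone : ∀ r : ℝ, 1 + r = ∑ x ∈ Fintype.piFinset fun _ : Fin d => V, P x + r := by
      simp [h1]
    rw [hone, Finset.sum_div, Finset.sum_div, ← Finset.sum_sub_distrib, Finset.mul_sum,
      ← Finset.sum_add_distrib, Finset.mul_sum]
    refine Finset.sum_congr rfl fun x _ => ?_
    rw [← Finset.sum_mul, ← Finset.sum_mul, urnBound]
    ring
  rw [hE]
  have hs1 : ∀ a c : ℝ, 0 < a → (∑ _j : Fin d, a / s * c) / a = d / s * c := by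
    intro a c ha
    rw [Finset.sum_const, Finset.card_univ, Fintype.card_fin, nsmul_eq_mul]
    field_simp
  rw [hs1 _ _ hB, hs1 _ _ hA]
  refine mul_le_of_le_one_right (urnDensity_pos _ _).le ?_
  rcases hvu.eq_or_lt with h | h
  · simp [h]
  · have hF : FB ≤ FA := by
      refine Finset.sum_le_sum_of_subset_of_nonneg ?_ fun i _ _ => by positivity
      intro i hi
      simp only [Finset.mem_filter] at hi ⊢
      exact ⟨hi.1, hi.2.trans_lt h⟩
    have h0 : 0 ≤ FB := Finset.sum_nonneg fun i _ => by positivity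
    have : (d : ℝ) / s * FB ^ (d - 1) ≤ d / s * FA ^ (d - 1) := by gcongr
    nlinarith

end Pair

/-! ### Ties of two vertices and newborns catching up -/

section PairProb

variable {Ω : Type*} [MeasurableSpace Ω] {μ : Measure Ω} {d : ℕ}
  {X : ℕ → Fin d → Ω → ℕ} {Y : ℕ → Ω → ℕ}

theorem IsMaxChoiceTree.exists_sample_eq (h : IsMaxChoiceTree μ d X Y) {n : ℕ} (hn : 1 ≤ n)
    (ω : Ω) : (∃ j, X n j ω = Y n ω) ∧
      ∀ j, deg (fun i => Y i ω) n (X n j ω) ≤ deg (fun i => Y i ω) n (Y n ω) := by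
  simpa [winners] using h.Y_mem n hn ω

theorem Admissible.sum_deg_div {y : ℕ → ℕ} (hy : Admissible y) {n : ℕ} (hn : 1 ≤ n) :
    ∑ i ∈ Finset.Icc 1 (n + 1), (deg y n i : ℝ) / (2 * n) = 1 := by
  have hn' : (0 : ℝ) < n := by exact_mod_cast hn
  rw [← Finset.sum_div, div_eq_one_iff_eq (by positivity)]
  exact_mod_cast hy.sum_deg hn

variable [IsProbabilityMeasure μ]

theorem IsMaxChoiceTree.setIntegral_urnDensity_succ_le (h : IsMaxChoiceTree μ d X Y) {n : ℕ}
    (hn : 1 ≤ n) {u v : ℕ} (huv : u ≠ v) (hu : u ∈ Finset.Icc 1 (n + 1))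
    (hv : v ∈ Finset.Icc 1 (n + 1)) {B : Set Ω} (hB : MeasurableSet[history Y n] B) :
    ∫ ω in B, urnDensity (deg (fun i => Y i ω) (n + 1) u) (deg (fun i => Y i ω) (n + 1) v) ∂μ ≤
      ∫ ω in B, urnDensity (deg (fun i => Y i ω) n u) (deg (fun i => Y i ω) n v) ∂μ := by
  have hn' : (0 : ℝ) < n := by exact_mod_cast hn
  refine h.setIntegral_succ_le hn
    (fun t => urnDensity (t.neighborSet u).ncard (t.neighborSet v).ncard)
    (fun t => urnDensity (t.neighborSet u).ncard (t.neighborSet v).ncard)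
    (fun t x => if (t.neighborSet v).ncard ≤ (t.neighborSet u).ncard
      then urnBound u v (fun i => (t.neighborSet i).ncard) x
      else urnBound v u (fun i => (t.neighborSet i).ncard) x) ?_ ?_ hB
  · intro ω
    have hadm := h.admissible ω
    obtain ⟨hy, hmax⟩ := h.exists_sample_eq hn ω
    have hu1 := hadm.one_le_deg hn hu
    have hv1 := hadm.one_le_deg hn hv
    simp only [Finset.mem_Icc] at hu hv
    have hu2 := hadm.deg_succ hn u
    have hv2 := hadm.deg_succ hn v
    rw [if_neg (by omega), zero_add] at hu2 hv2
    change urnDensity (deg (fun i => Y i ω) (n + 1) u) (deg (fun i => Y i ω) (n + 1) v) ≤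
      if deg (fun i => Y i ω) n v ≤ deg (fun i => Y i ω) n u
      then urnBound u v (deg (fun i => Y i ω) n) fun j => X n j ω
      else urnBound v u (deg (fun i => Y i ω) n) fun j => X n j ω
    rw [hu2, hv2]
    generalize deg (fun i => Y i ω) n = D at *
    by_cases hle : D v ≤ D u
    · rw [if_pos hle]
      exact urnDensity_le_urnBound huv hv1 hle hy hmax
    · rw [if_neg hle, urnDensity_comm]
      exact urnDensity_le_urnBound huv.symm hu1 (not_le.1 hle).le hy hmax
  · intro ω
    have hadm := h.admissible ω
    have hu1 := hadm.one_le_deg hn hu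
    have hv1 := hadm.one_le_deg hn hv
    have hsum := hadm.sum_deg_div hn
    change ∑ x ∈ Fintype.piFinset fun _ : Fin d => Finset.Icc 1 (n + 1),
      (if deg (fun i => Y i ω) n v ≤ deg (fun i => Y i ω) n u
        then urnBound u v (deg (fun i => Y i ω) n) x
        else urnBound v u (deg (fun i => Y i ω) n) x) *
        ∏ j, (deg (fun i => Y i ω) n (x j) : ℝ) / (2 * n) ≤
      urnDensity (deg (fun i => Y i ω) n u) (deg (fun i => Y i ω) n v)
    generalize deg (fun i => Y i ω) n = D at *
    by_cases hle : D v ≤ D u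
    · simp only [if_pos hle]
      exact sum_urnBound_le hu hv hv1 hle (by positivity) hsum
    · simp only [if_neg hle]
      rw [urnDensity_comm]
      exact sum_urnBound_le hv hu hu1 (not_le.1 hle).le (by positivity) hsum

/-- Almost surely, two given vertices have equal degrees only while these are bounded. -/
theorem IsMaxChoiceTree.ae_exists_forall_deg_le (h : IsMaxChoiceTree μ d X Y) {u v : ℕ}
    (huv : u ≠ v) (hu : 1 ≤ u) (hv : 1 ≤ v) :
    ∀ᵐ ω ∂μ, ∃ C : ℕ, ∀ n, u + v ≤ n → deg (fun i => Y i ω) n u = deg (fun i => Y i ω) n v →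
      deg (fun i => Y i ω) n u ≤ C := by
  have hmem : ∀ k, 1 ≤ u + v + k ∧ u ∈ Finset.Icc 1 (u + v + k + 1) ∧
      v ∈ Finset.Icc 1 (u + v + k + 1) := by
    intro k
    simp only [Finset.mem_Icc]
    omega
  have hbd := ae_exists_forall_le (μ := μ) (F := fun k => history Y (u + v + k))
    (Z := fun k ω => urnDensity (deg (fun i => Y i ω) (u + v + k) u)
      (deg (fun i => Y i ω) (u + v + k) v))
    (fun _ _ hk => history_mono Y (by omega))
    (fun k => history_le h.measurable_Y _)
    (fun k ω => (urnDensity_pos _ _).le)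
    (fun k => measurable_history_tree (hmem k).1
      fun t => urnDensity (t.neighborSet u).ncard (t.neighborSet v).ncard)
    (fun k => integrable_tree h.measurable_Y h.admissible (hmem k).1
      fun t => urnDensity (t.neighborSet u).ncard (t.neighborSet v).ncard)
    (fun k B hB => h.setIntegral_urnDensity_succ_le (hmem k).1 huv (hmem k).2.1 (hmem k).2.2 hB)
  filter_upwards [hbd] with ω ⟨C, hC⟩
  -- At a tie of degree m, m/16 ≤ W(m, m)² ≤ C².
  refine ⟨⌈16 * C ^ 2⌉₊, fun n hn heq => ?_⟩
  obtain ⟨k, rfl⟩ := Nat.exists_eq_add_of_le hn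
  have h1 := hC k
  rw [← heq] at h1
  have h2 := urnDensity_self_sq_ge ((h.admissible ω).one_le_deg (hmem k).1 (hmem k).2.1)
  have h3 := urnDensity_pos (deg (fun i => Y i ω) (u + v + k) u)
    (deg (fun i => Y i ω) (u + v + k) u)
  have h4 : (deg (fun i => Y i ω) (u + v + k) u : ℝ) ≤ 16 * C ^ 2 := by
    nlinarith [pow_le_pow_left₀ h3.le h1 2]
  exact_mod_cast h4.trans (Nat.le_ceil _)

theorem div_two_pow_succ_anti {a b : ℕ} (ha : 1 ≤ a) (hab : a ≤ b) :
    (b : ℝ) / 2 ^ (b + 1) ≤ a / 2 ^ (a + 1) := by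
  induction b, hab using Nat.le_induction with
  | base => rfl
  | succ b hb ih =>
    refine le_trans ?_ ih
    have : (1 : ℝ) ≤ b := by exact_mod_cast ha.trans hb
    rw [pow_succ 2 (b + 1), div_le_div_iff₀ (by positivity) (by positivity)]
    push_cast
    have h2 : (0 : ℝ) < 2 ^ (b + 1) := by positivity
    nlinarith

/-- The probability that the newborn vertex ever catches up with a vertex of degree at least `a`
is exponentially small in `a`. -/
theorem IsMaxChoiceTree.measureReal_catch_up_le (h : IsMaxChoiceTree μ d X Y) {n : ℕ} (hn : 1 ≤ n)
    {u : ℕ} (hu : u ∈ Finset.Icc 1 (n + 1)) {a : ℕ} (ha : 1 ≤ a) :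
    μ.real {ω | a ≤ deg (fun i => Y i ω) (n + 1) u ∧ ∃ m, n + 1 ≤ m ∧
      deg (fun i => Y i ω) m u = deg (fun i => Y i ω) m (n + 2)} ≤ 4 * (a / 2 ^ (a + 1)) := by
  have hu' := Finset.mem_Icc.1 hu
  have hmem : ∀ k, 1 ≤ n + 1 + k ∧ u ∈ Finset.Icc 1 (n + 1 + k + 1) ∧
      n + 2 ∈ Finset.Icc 1 (n + 1 + k + 1) := by
    intro k
    simp only [Finset.mem_Icc]
    omega
  have hB : MeasurableSet[history Y (n + 1 + 0)] {ω | a ≤ deg (fun i => Y i ω) (n + 1) u} :=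
    measurableSet_history_tree (by omega) {t | a ≤ (t.neighborSet u).ncard}
  have hmax := mul_measureReal_exists_le (μ := μ) (F := fun k => history Y (n + 1 + k))
    (Z := fun k ω => urnDensity (deg (fun i => Y i ω) (n + 1 + k) u)
      (deg (fun i => Y i ω) (n + 1 + k) (n + 2)))
    (fun _ _ hk => history_mono Y (by omega))
    (fun k => history_le h.measurable_Y _)
    (fun k ω => (urnDensity_pos _ _).le)
    (fun k => measurable_history_tree (hmem k).1
      fun t => urnDensity (t.neighborSet u).ncard (t.neighborSet (n + 2)).ncard)
    (fun k => integrable_tree h.measurable_Y h.admissible (hmem k).1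
      fun t => urnDensity (t.neighborSet u).ncard (t.neighborSet (n + 2)).ncard)
    (fun k B hB => h.setIntegral_urnDensity_succ_le (hmem k).1 (by omega) (hmem k).2.1
      (hmem k).2.2 hB)
    hB (1 / 4)
  have hint : ∫ ω in {ω | a ≤ deg (fun i => Y i ω) (n + 1) u},
      urnDensity (deg (fun i => Y i ω) (n + 1 + 0) u)
        (deg (fun i => Y i ω) (n + 1 + 0) (n + 2)) ∂μ ≤ a / 2 ^ (a + 1) := by
    calc _ ≤ ∫ ω in {ω | a ≤ deg (fun i => Y i ω) (n + 1) u}, (a / 2 ^ (a + 1) : ℝ) ∂μ := by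
          refine setIntegral_mono_on (integrable_tree h.measurable_Y h.admissible (hmem 0).1
            fun t => urnDensity (t.neighborSet u).ncard
              (t.neighborSet (n + 2)).ncard).integrableOn
            (integrable_const _).integrableOn (history_le h.measurable_Y _ _ hB) fun ω hω => ?_
          rw [add_zero, (h.admissible ω).deg_newborn hn, urnDensity_one_right (ha.trans hω)]
          exact div_two_pow_succ_anti ha hω
      _ ≤ _ := by
          rw [setIntegral_const, smul_eq_mul]
          exact mul_le_of_le_one_left (by positivity) measureReal_le_one
  have hsub : μ.real {ω | a ≤ deg (fun i => Y i ω) (n + 1) u ∧ ∃ m, n + 1 ≤ m ∧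
      deg (fun i => Y i ω) m u = deg (fun i => Y i ω) m (n + 2)} ≤
      μ.real ({ω | a ≤ deg (fun i => Y i ω) (n + 1) u} ∩
        {ω | ∃ k, 1 / 4 ≤ urnDensity (deg (fun i => Y i ω) (n + 1 + k) u)
          (deg (fun i => Y i ω) (n + 1 + k) (n + 2))}) := by
    refine measureReal_mono ?_
    rintro ω ⟨h1, m, hm, heq⟩
    obtain ⟨k, rfl⟩ := Nat.exists_eq_add_of_le hm
    refine ⟨h1, k, ?_⟩
    rw [← heq]
    exact urnDensity_self_ge ((h.admissible ω).one_le_deg (hmem k).1 (hmem k).2.1)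
  linarith

/-- A degree threshold of order `log n`. -/
def threshold (n : ℕ) : ℕ := 4 * Nat.log 2 n + 2

theorem summable_threshold :
    Summable fun n : ℕ => ((n : ℝ) + 1) * (4 * (threshold n / 2 ^ (threshold n + 1))) := by
  -- For n ≥ 1, threshold n ≤ 6n and 2^(threshold n + 1) ≥ n⁴/2, giving 96/n². The second summand
  -- covers n = 0, where the term equals 1 but 1/n² reads as 0.
  refine Summable.of_nonneg_of_le (fun n => by positivity) (fun n => ?_)
    ((Real.summable_one_div_nat_pow.2 one_lt_two).mul_left 96 |>.add
      (summable_of_hasFiniteSupport (f := fun n : ℕ => if n = 0 then (1 : ℝ) else 0)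
        ((Set.finite_singleton 0).subset fun n hn => by
          by_contra h
          exact hn (if_neg h))))
  rcases Nat.eq_zero_or_pos n with rfl | hn
  · norm_num [threshold]
  · rw [if_neg hn.ne', add_zero]
    have hn' : (1 : ℝ) ≤ n := by exact_mod_cast hn
    have h1 : (Nat.log 2 n : ℝ) ≤ n := by exact_mod_cast Nat.log_le_self 2 n
    have h2 : (n : ℝ) ≤ 2 * 2 ^ Nat.log 2 n := by
      have := Nat.lt_pow_succ_log_self one_lt_two n
      rw [pow_succ] at this
      exact_mod_cast (by omega : n ≤ 2 * 2 ^ Nat.log 2 n)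
    have h3 : (n : ℝ) ^ 4 / 2 ≤ 2 ^ (threshold n + 1) := by
      have := pow_le_pow_left₀ (by positivity) h2 4
      rw [threshold, show 4 * Nat.log 2 n + 2 + 1 = Nat.log 2 n * 4 + 3 by ring, pow_add, pow_mul]
      rw [mul_pow] at this
      linarith
    have h4 : (threshold n : ℝ) ≤ 6 * n := by
      rw [threshold]; push_cast; linarith
    calc ((n : ℝ) + 1) * (4 * (threshold n / 2 ^ (threshold n + 1)))
        ≤ (n + n) * (4 * (6 * n / (n ^ 4 / 2))) := by gcongr
      _ = 96 * (1 / n ^ 2) := by field_simp; ring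

/-- Almost surely, only finitely many vertices catch up with a vertex whose degree was above the
threshold when they were born. -/
theorem IsMaxChoiceTree.ae_eventually_ne (h : IsMaxChoiceTree μ d X Y) :
    ∀ᵐ ω ∂μ, ∀ᶠ n in Filter.atTop, ∀ u ∈ Finset.Icc 1 (n + 1),
      threshold n ≤ deg (fun i => Y i ω) (n + 1) u → ∀ m, n + 1 ≤ m →
        deg (fun i => Y i ω) m u ≠ deg (fun i => Y i ω) m (n + 2) := by
  set E : ℕ → Set Ω := fun n => if n = 0 then ∅ else ⋃ u ∈ Finset.Icc 1 (n + 1),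
    {ω | threshold n ≤ deg (fun i => Y i ω) (n + 1) u ∧ ∃ m, n + 1 ≤ m ∧
      deg (fun i => Y i ω) m u = deg (fun i => Y i ω) m (n + 2)} with hE
  have hle : ∀ n, μ (E n) ≤
      ENNReal.ofReal (((n : ℝ) + 1) * (4 * (threshold n / 2 ^ (threshold n + 1)))) := by
    intro n
    rw [← ofReal_measureReal]
    refine ENNReal.ofReal_le_ofReal ?_
    simp only [hE]
    split_ifs with hn
    · rw [measureReal_empty]
      positivity
    · refine (measureReal_biUnion_finset_le _ _).trans ?_
      refine (Finset.sum_le_sum fun u hu => h.measureReal_catch_up_le (by omega) hu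
        (by simp [threshold])).trans ?_
      rw [Finset.sum_const, Nat.card_Icc, nsmul_eq_mul]
      simp
  have hsum : ∑' n, μ (E n) ≠ ⊤ :=
    ne_top_of_le_ne_top summable_threshold.tsum_ofReal_ne_top (ENNReal.tsum_le_tsum hle)
  filter_upwards [ae_eventually_notMem hsum] with ω hω
  filter_upwards [hω, Filter.eventually_ge_atTop 1] with n hn hn1 u hu hdeg m hm heq
  refine hn ?_
  simp only [hE]
  rw [if_neg (by omega)]
  exact Set.mem_biUnion (Finset.mem_coe.2 hu) ⟨hdeg, m, hm, heq⟩

end PairProb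

/-! ### The minimal sum of inverse degrees -/

/-- The smallest sum of the inverse degrees of `l` vertices among `1, …, n + 1`. -/
noncomputable def minInvSum (l n : ℕ) (D : ℕ → ℕ) : ℝ :=
  ⨅ U : {U // U ∈ (Finset.Icc 1 (n + 1)).powersetCard l}, ∑ u ∈ U.1, 1 / (D u : ℝ)

section MinInvSum

variable {l n : ℕ} {D : ℕ → ℕ}

theorem minInvSum_nonneg (l n : ℕ) (D : ℕ → ℕ) : 0 ≤ minInvSum l n D :=
  Real.iInf_nonneg fun _ => Finset.sum_nonneg fun _ _ => by positivity

theorem minInvSum_le {U : Finset ℕ} (hU : U ∈ (Finset.Icc 1 (n + 1)).powersetCard l) :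
    minInvSum l n D ≤ ∑ u ∈ U, 1 / (D u : ℝ) :=
  ciInf_le (f := fun U : {U // U ∈ (Finset.Icc 1 (n + 1)).powersetCard l} =>
    ∑ u ∈ U.1, 1 / (D u : ℝ)) (Set.finite_range _).bddBelow ⟨U, hU⟩

theorem exists_minInvSum_eq (hl : l ≤ n + 1) (D : ℕ → ℕ) :
    ∃ U ∈ (Finset.Icc 1 (n + 1)).powersetCard l, minInvSum l n D = ∑ u ∈ U, 1 / (D u : ℝ) := by
  have hne : ((Finset.Icc 1 (n + 1)).powersetCard l).Nonempty :=
    Finset.powersetCard_nonempty.2 (by simpa using hl)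
  have : Nonempty {U // U ∈ (Finset.Icc 1 (n + 1)).powersetCard l} := hne.to_subtype
  obtain ⟨U, hU⟩ := exists_eq_ciInf_of_finite
    (f := fun U : {U // U ∈ (Finset.Icc 1 (n + 1)).powersetCard l} => ∑ u ∈ U.1, 1 / (D u : ℝ))
  exact ⟨U.1, U.2, hU.symm⟩

/-- If the `j`-th sample is some u in U and no sample exceeds it, the chosen vertex y has the same
degree as u. Should y lie outside U, exchanging u for y leaves the sum unchanged, so the sum drops
by at least the increment at y. Fixing the index `j` makes the events for different u disjoint. -/
theorem minInvSum_succ_le {d : ℕ} {D' : ℕ → ℕ} {U : Finset ℕ} {x : Fin d → ℕ} {y : ℕ} (j : Fin d)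
    (hU : U ∈ (Finset.Icc 1 (n + 1)).powersetCard l) (hy : y ∈ Finset.Icc 1 (n + 1))
    (hD : ∀ i ∈ Finset.Icc 1 (n + 1), 1 ≤ D i) (hDD : ∀ i, D i ≤ D' i) (hDy : D y + 1 ≤ D' y)
    (hxy : ∃ j, x j = y) (hmax : ∀ j, D (x j) ≤ D y) :
    minInvSum l (n + 1) D' ≤ ∑ u ∈ U, 1 / (D u : ℝ) -
      ∑ u ∈ U, (if x j = u ∧ ∀ i, i ≠ j → D (x i) ≤ D u then (1 : ℝ) else 0) *
        (1 / D u - 1 / (D u + 1)) := by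
  rw [Finset.mem_powersetCard] at hU
  have hV : Finset.Icc 1 (n + 1) ⊆ Finset.Icc 1 (n + 1 + 1) :=
    Finset.Icc_subset_Icc_right (by omega)
  have hle : ∀ i ∈ Finset.Icc 1 (n + 1), 1 / (D' i : ℝ) ≤ 1 / D i := fun i hi =>
    one_div_le_one_div_of_le (by exact_mod_cast hD i hi) (by exact_mod_cast hDD i)
  by_cases h : ∃ u ∈ U, x j = u ∧ ∀ i, i ≠ j → D (x i) ≤ D u
  · obtain ⟨u, hu, hju, hlt⟩ := h
    have hyu : D y = D u := by
      refine le_antisymm ?_ (hju ▸ hmax j)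
      obtain ⟨i, rfl⟩ := hxy
      by_cases hij : i = j
      · rw [hij, hju]
      · exact hlt i hij
    have hsum : ∑ u ∈ U, (if x j = u ∧ ∀ i, i ≠ j → D (x i) ≤ D u then (1 : ℝ) else 0) *
        (1 / D u - 1 / (D u + 1)) = 1 / D y - 1 / (D y + 1) := by
      rw [Finset.sum_eq_single_of_mem u hu, if_pos ⟨hju, hlt⟩, hyu, one_mul]
      intro v _ hvu
      rw [if_neg fun hh => hvu (hh.1.symm.trans hju), zero_mul]
    rw [hsum]
    obtain ⟨w, hw, hwy, hDw⟩ : ∃ w ∈ U, y ∉ U.erase w ∧ D w = D y := by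
      by_cases hyU : y ∈ U
      · exact ⟨y, hyU, Finset.notMem_erase y U, rfl⟩
      · exact ⟨u, hu, fun h => hyU (Finset.mem_of_mem_erase h), hyu.symm⟩
    have hU' : insert y (U.erase w) ∈ (Finset.Icc 1 (n + 1 + 1)).powersetCard l := by
      rw [Finset.mem_powersetCard]
      constructor
      · exact (Finset.insert_subset hy ((Finset.erase_subset _ _).trans hU.1)).trans hV
      · rw [Finset.card_insert_of_notMem hwy, Finset.card_erase_add_one hw, hU.2]
    refine (minInvSum_le hU').trans ?_
    rw [Finset.sum_insert hwy, ← Finset.add_sum_erase U _ hw, hDw]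
    have h1 : 1 / (D' y : ℝ) ≤ 1 / (D y + 1) :=
      one_div_le_one_div_of_le (by positivity) (by exact_mod_cast hDy)
    have h2 := Finset.sum_le_sum fun i hi => hle i (hU.1 (Finset.mem_of_mem_erase (a := w) hi))
    linarith
  · rw [Finset.sum_eq_zero (s := U) (f := fun u =>
      (if x j = u ∧ ∀ i, i ≠ j → D (x i) ≤ D u then (1 : ℝ) else 0) *
        (1 / D u - 1 / (D u + 1))), sub_zero]
    · exact (minInvSum_le (Finset.mem_powersetCard.2 ⟨hU.1.trans hV, hU.2⟩)).trans
        (Finset.sum_le_sum fun i hi => hle i (hU.1 hi))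
    · intro u hu
      rw [if_neg fun hh => h ⟨u, hu, hh⟩, zero_mul]

/-- Vertices of degree larger than that of a vertex of an optimal set belong to the set. -/
theorem mem_of_minInvSum_eq {U : Finset ℕ}
    (hU : U ∈ (Finset.Icc 1 (n + 1)).powersetCard l) (hD : ∀ i ∈ Finset.Icc 1 (n + 1), 1 ≤ D i)
    (hmin : minInvSum l n D = ∑ u ∈ U, 1 / (D u : ℝ)) {u i : ℕ} (hu : u ∈ U)
    (hi : i ∈ Finset.Icc 1 (n + 1)) (hui : D u < D i) : i ∈ U := by
  by_contra hiU
  rw [Finset.mem_powersetCard] at hU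
  have hie : i ∉ U.erase u := fun h => hiU (Finset.mem_of_mem_erase h)
  have hU' : insert i (U.erase u) ∈ (Finset.Icc 1 (n + 1)).powersetCard l := by
    rw [Finset.mem_powersetCard]
    constructor
    · exact Finset.insert_subset hi ((Finset.erase_subset _ _).trans hU.1)
    · rw [Finset.card_insert_of_notMem hie, Finset.card_erase_add_one hu, hU.2]
  have h1 := minInvSum_le (D := D) hU'
  rw [hmin, Finset.sum_insert hie, ← Finset.add_sum_erase U _ hu] at h1
  have h2 : 1 / (D i : ℝ) < 1 / D u :=
    one_div_lt_one_div_of_lt (by exact_mod_cast hD u (hU.1 hu)) (by exact_mod_cast hui)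
  linarith

/-- By optimality every vertex outside U has degree at most D u. There are at least n/2 of them,
each sampled with probability at least 1/(2n). -/
theorem quarter_le_sum {U : Finset ℕ} (hn : 1 ≤ n) (hln : 2 * l ≤ n)
    (hU : U ∈ (Finset.Icc 1 (n + 1)).powersetCard l) (hD : ∀ i ∈ Finset.Icc 1 (n + 1), 1 ≤ D i)
    (hmin : minInvSum l n D = ∑ u ∈ U, 1 / (D u : ℝ)) {u : ℕ} (hu : u ∈ U) :
    1 / 4 ≤ ∑ i ∈ Finset.Icc 1 (n + 1) with D i ≤ D u, (D i : ℝ) / (2 * n) := by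
  have hn' : (0 : ℝ) < n := by exact_mod_cast hn
  have hsub : Finset.Icc 1 (n + 1) \ U ⊆ {i ∈ Finset.Icc 1 (n + 1) | D i ≤ D u} := by
    intro i hi
    rw [Finset.mem_sdiff] at hi
    rw [Finset.mem_filter]
    exact ⟨hi.1, not_lt.1 fun h => hi.2 (mem_of_minInvSum_eq hU hD hmin hu hi.1 h)⟩
  have hU' := Finset.mem_powersetCard.1 hU
  have hcard := Finset.card_sdiff_of_subset hU'.1
  rw [Nat.card_Icc, hU'.2] at hcard
  have hcard' : (n : ℝ) / 2 ≤ (Finset.Icc 1 (n + 1) \ U).card := by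
    have : n ≤ 2 * (Finset.Icc 1 (n + 1) \ U).card := by omega
    have : (n : ℝ) ≤ 2 * (Finset.Icc 1 (n + 1) \ U).card := by exact_mod_cast this
    linarith
  calc (1 : ℝ) / 4 = n / 2 * (1 / (2 * n)) := by field_simp; norm_num
    _ ≤ (Finset.Icc 1 (n + 1) \ U).card * (1 / (2 * n)) := by gcongr
    _ = ∑ i ∈ Finset.Icc 1 (n + 1) \ U, (1 : ℝ) / (2 * n) := by simp
    _ ≤ ∑ i ∈ Finset.Icc 1 (n + 1) \ U, (D i : ℝ) / (2 * n) := by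
        refine Finset.sum_le_sum fun i hi => ?_
        gcongr
        exact_mod_cast hD i (Finset.mem_sdiff.1 hi).1
    _ ≤ _ := Finset.sum_le_sum_of_subset_of_nonneg hsub fun i _ _ => by positivity

/-- Each u in U is hit with probability at least D u / (2n) · (1/4)^(d-1), and then 1/D u loses 1/(D
u (D u + 1)) ≥ 1/(2 (D u)²). The product is (1/4)^d / n times 1/D u. -/
theorem sum_invSum_bound_le {d : ℕ} {U : Finset ℕ} (j : Fin d) (hn : 1 ≤ n) (hln : 2 * l ≤ n)
    (hU : U ∈ (Finset.Icc 1 (n + 1)).powersetCard l) (hD : ∀ i ∈ Finset.Icc 1 (n + 1), 1 ≤ D i)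
    (hmin : minInvSum l n D = ∑ u ∈ U, 1 / (D u : ℝ))
    (hp : ∑ i ∈ Finset.Icc 1 (n + 1), (D i : ℝ) / (2 * n) = 1) :
    ∑ x ∈ Fintype.piFinset fun _ : Fin d => Finset.Icc 1 (n + 1),
      (∑ u ∈ U, 1 / (D u : ℝ) -
        ∑ u ∈ U, (if x j = u ∧ ∀ i, i ≠ j → D (x i) ≤ D u then (1 : ℝ) else 0) *
        (1 / D u - 1 / (D u + 1))) * ∏ i, (D (x i) : ℝ) / (2 * n) ≤
      (1 - (1 / 4) ^ d / n) * minInvSum l n D := by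
  have hn' : (0 : ℝ) < n := by exact_mod_cast hn
  have hU' := (Finset.mem_powersetCard.1 hU).1
  have hd : d - 1 + 1 = d := by have := j.pos; omega
  simp only [sub_mul, Finset.sum_sub_distrib, ← Finset.mul_sum]
  rw [sum_piFinset_prod_eq_one (p := fun i => (D i : ℝ) / (2 * n)) hp, mul_one, one_mul, hmin]
  refine sub_le_sub_left ?_ _
  simp only [Finset.sum_mul]
  rw [Finset.sum_comm, Finset.mul_sum]
  refine Finset.sum_le_sum fun u hu => ?_
  have h1 : ∑ x ∈ Fintype.piFinset fun _ : Fin d => Finset.Icc 1 (n + 1),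
      (if x j = u ∧ ∀ i, i ≠ j → D (x i) ≤ D u then (1 : ℝ) else 0) *
        (1 / D u - 1 / (D u + 1)) * ∏ i, (D (x i) : ℝ) / (2 * n) =
      D u / (2 * n) * (∑ i ∈ Finset.Icc 1 (n + 1) with D i ≤ D u, (D i : ℝ) / (2 * n)) ^ (d - 1) *
        (1 / D u - 1 / (D u + 1)) := by
    rw [← sum_piFinset_ite_mul_prod (fun i => (D i : ℝ) / (2 * n)) j (hU' hu) fun i => D i ≤ D u,
      Finset.sum_mul]
    exact Finset.sum_congr rfl fun x _ => by ring
  rw [h1]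
  have hDu : (1 : ℝ) ≤ D u := by exact_mod_cast hD u (hU' hu)
  have h2 : (1 : ℝ) / D u - 1 / (D u + 1) = 1 / (D u * (D u + 1)) := by field_simp; ring
  rw [h2]
  calc (1 / 4 : ℝ) ^ d / n * (1 / D u)
      = D u / (2 * n) * (1 / 4) ^ (d - 1) * (1 / (D u * (D u + D u))) := by
        nth_rw 1 [← hd]
        rw [pow_succ]
        field_simp
        norm_num
    _ ≤ _ := by
        gcongr
        exact quarter_le_sum hn hln hU hD hmin hu

end MinInvSum

/-! ### Polynomial growth of the largest degrees -/

section Growth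

/-- Bernoulli gives (1 + 1/n)^κ ≤ 1 + κ/n, and (1 + κ/n)(1 - κ/n) ≤ 1. Thus the weight n^κ absorbs
the contraction factor 1 - κ/n. -/
theorem rpow_succ_mul_le {κ : ℝ} (h0 : 0 ≤ κ) (h1 : κ ≤ 1) {n : ℕ} (hn : 1 ≤ n) :
    ((n + 1 : ℕ) : ℝ) ^ κ * (1 - κ / n) ≤ (n : ℝ) ^ κ := by
  have hn' : (1 : ℝ) ≤ n := by exact_mod_cast hn
  have hκ : κ / n ≤ 1 := (div_le_one (by linarith)).2 (h1.trans hn')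
  have h2 : ((n + 1 : ℕ) : ℝ) ^ κ ≤ (n : ℝ) ^ κ * (1 + κ / n) := by
    have : ((n + 1 : ℕ) : ℝ) = n * (1 + 1 / n) := by push_cast; field_simp
    rw [this, Real.mul_rpow (by positivity) (by positivity)]
    gcongr
    have := rpow_one_add_le_one_add_mul_self (s := 1 / (n : ℝ))
      (by have : (0 : ℝ) ≤ 1 / n := by positivity
          linarith) h0 h1
    calc _ ≤ _ := this
      _ = _ := by ring
  calc ((n + 1 : ℕ) : ℝ) ^ κ * (1 - κ / n) ≤ (n : ℝ) ^ κ * (1 + κ / n) * (1 - κ / n) :=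
        mul_le_mul_of_nonneg_right h2 (by linarith)
    _ = (n : ℝ) ^ κ * (1 - (κ / n) ^ 2) := by ring
    _ ≤ (n : ℝ) ^ κ := mul_le_of_le_one_right (by positivity) (by nlinarith [sq_nonneg (κ / n)])

theorem threshold_isLittleO {κ : ℝ} (hκ : 0 < κ) :
    (fun n : ℕ => (threshold n : ℝ)) =o[Filter.atTop] fun n : ℕ => (n : ℝ) ^ κ := by
  have h1 : (fun n : ℕ => 4 / Real.log 2 * Real.log n + 2) =o[Filter.atTop]
      fun n : ℕ => (n : ℝ) ^ κ := by
    refine (((isLittleO_log_rpow_atTop hκ).comp_tendsto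
      tendsto_natCast_atTop_atTop).const_mul_left _).add ?_
    refine Asymptotics.isLittleO_const_left.2 (Or.inr ?_)
    exact tendsto_norm_atTop_atTop.comp
      ((tendsto_rpow_atTop hκ).comp tendsto_natCast_atTop_atTop)
  refine Asymptotics.IsBigO.trans_isLittleO ?_ h1
  refine Asymptotics.IsBigO.of_bound 1 ?_
  filter_upwards [Filter.eventually_ge_atTop 1] with n hn
  have hn' : (1 : ℝ) ≤ n := by exact_mod_cast hn
  have h2 := Real.natLog_le_logb n 2
  rw [Real.logb] at h2
  have h3 : 0 ≤ Real.log n := Real.log_nonneg hn'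
  have h4 : 0 < Real.log 2 := Real.log_pos one_lt_two
  rw [one_mul, Real.norm_of_nonneg (by positivity), Real.norm_of_nonneg (by positivity), threshold]
  push_cast at h2 ⊢
  calc (4 : ℝ) * Nat.log 2 n + 2 ≤ 4 * (Real.log n / Real.log 2) + 2 := by gcongr
    _ = _ := by ring

variable {Ω : Type*} [MeasurableSpace Ω] {μ : Measure Ω} [IsProbabilityMeasure μ] {d : ℕ}
  {X : ℕ → Fin d → Ω → ℕ} {Y : ℕ → Ω → ℕ}

theorem IsMaxChoiceTree.setIntegral_minInvSum_succ_le (h : IsMaxChoiceTree μ d X Y) (hd : 1 ≤ d)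
    {l n : ℕ} (hn : 1 ≤ n) (hln : 2 * l ≤ n) {B : Set Ω} (hB : MeasurableSet[history Y n] B) :
    ∫ ω in B, ((n + 1 : ℕ) : ℝ) ^ ((1 / 4 : ℝ) ^ d) *
        minInvSum l (n + 1) (deg (fun i => Y i ω) (n + 1)) ∂μ ≤
      ∫ ω in B, (n : ℝ) ^ ((1 / 4 : ℝ) ^ d) * minInvSum l n (deg (fun i => Y i ω) n) ∂μ := by
  -- The optimal set is chosen as a function of the degrees alone, so that the one-step bound
  -- depends only on the tree and the samples.
  choose U hU hmin using fun D : ℕ → ℕ => exists_minInvSum_eq (show l ≤ n + 1 by omega) D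
  set κ : ℝ := (1 / 4) ^ d with hκ
  refine h.setIntegral_succ_le hn
    (fun t => (n : ℝ) ^ κ * minInvSum l n fun i => (t.neighborSet i).ncard)
    (fun t => ((n + 1 : ℕ) : ℝ) ^ κ * minInvSum l (n + 1) fun i => (t.neighborSet i).ncard)
    (fun t x => ((n + 1 : ℕ) : ℝ) ^ κ *
      (fun D : ℕ → ℕ => ∑ u ∈ U D, 1 / (D u : ℝ) - ∑ u ∈ U D,
        (if x ⟨0, hd⟩ = u ∧ ∀ i, i ≠ ⟨0, hd⟩ → D (x i) ≤ D u then (1 : ℝ) else 0) *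
        (1 / D u - 1 / (D u + 1))) fun i => (t.neighborSet i).ncard) ?_ ?_ hB
  · intro ω
    have hadm := h.admissible ω
    obtain ⟨hxy, hmax⟩ := h.exists_sample_eq hn ω
    refine mul_le_mul_of_nonneg_left ?_ (by positivity)
    exact minInvSum_succ_le (D := deg (fun i => Y i ω) n) (D' := deg (fun i => Y i ω) (n + 1))
      (x := fun j => X n j ω) (y := Y n ω) ⟨0, hd⟩ (hU _) (hadm n hn)
      (fun i hi => hadm.one_le_deg hn hi) (fun i => hadm.deg_mono hn n.le_succ i)
      (by rw [hadm.deg_succ hn (Y n ω), if_pos (rfl : Y n ω = Y n ω)]; omega) hxy hmax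
  · intro ω
    have hadm := h.admissible ω
    have hbound := sum_invSum_bound_le (D := deg (fun i => Y i ω) n) (⟨0, hd⟩ : Fin d) hn hln
      (hU _) (fun i hi => hadm.one_le_deg hn hi) (hmin _) (hadm.sum_deg_div hn)
    have hpow := rpow_succ_mul_le (κ := κ) (by positivity)
      (pow_le_one₀ (by norm_num) (by norm_num)) hn
    have h0 := minInvSum_nonneg l n (deg (fun i => Y i ω) n)
    simp only [mul_assoc, ← Finset.mul_sum]
    calc _ ≤ ((n + 1 : ℕ) : ℝ) ^ κ *
          ((1 - κ / n) * minInvSum l n (deg (fun i => Y i ω) n)) :=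
          mul_le_mul_of_nonneg_left hbound (by positivity)
      _ = ((n + 1 : ℕ) : ℝ) ^ κ * (1 - κ / n) * minInvSum l n (deg (fun i => Y i ω) n) := by ring
      _ ≤ _ := mul_le_mul_of_nonneg_right hpow h0

/-- Almost surely, eventually at least `l` vertices have a degree above the threshold. -/
theorem IsMaxChoiceTree.ae_eventually_threshold (h : IsMaxChoiceTree μ d X Y) (hd : 1 ≤ d)
    (l : ℕ) : ∀ᵐ ω ∂μ, ∀ᶠ n in Filter.atTop, ∃ U ∈ (Finset.Icc 1 (n + 1)).powersetCard l,
      ∀ u ∈ U, threshold n ≤ deg (fun i => Y i ω) n u := by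
  set κ : ℝ := (1 / 4) ^ d with hκ
  have hbd := ae_exists_forall_le (μ := μ) (F := fun k => history Y (2 * l + 1 + k))
    (Z := fun k ω => ((2 * l + 1 + k : ℕ) : ℝ) ^ κ *
      minInvSum l (2 * l + 1 + k) (deg (fun i => Y i ω) (2 * l + 1 + k)))
    (fun _ _ hk => history_mono Y (by omega))
    (fun k => history_le h.measurable_Y _)
    (fun k ω => mul_nonneg (by positivity) (minInvSum_nonneg _ _ _))
    (fun k => measurable_history_tree (by omega) fun t => ((2 * l + 1 + k : ℕ) : ℝ) ^ κ *
      minInvSum l (2 * l + 1 + k) fun i => (t.neighborSet i).ncard)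
    (fun k => integrable_tree h.measurable_Y h.admissible (by omega) fun t =>
      ((2 * l + 1 + k : ℕ) : ℝ) ^ κ *
        minInvSum l (2 * l + 1 + k) fun i => (t.neighborSet i).ncard)
    (fun k B hB => h.setIntegral_minInvSum_succ_le (l := l) (n := 2 * l + 1 + k) hd (by omega)
      (by omega) hB)
  filter_upwards [hbd] with ω ⟨C, hC⟩
  have hadm := h.admissible ω
  set C' := max C 1 with hC'
  have hC1 : 1 ≤ C' := le_max_right _ _
  have hκ0 : 0 < κ := by positivity
  filter_upwards [(threshold_isLittleO hκ0).bound (inv_pos.2 (by linarith : 0 < C')),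
    Filter.eventually_ge_atTop (2 * l + 1)] with n hn hln
  obtain ⟨k, rfl⟩ := Nat.exists_eq_add_of_le hln
  obtain ⟨U, hU, hmin⟩ := exists_minInvSum_eq (show l ≤ 2 * l + 1 + k + 1 by omega)
    (deg (fun i => Y i ω) (2 * l + 1 + k))
  refine ⟨U, hU, fun u hu => ?_⟩
  have hdu : (1 : ℝ) ≤ deg (fun i => Y i ω) (2 * l + 1 + k) u := by
    exact_mod_cast hadm.one_le_deg (by omega) ((Finset.mem_powersetCard.1 hU).1 hu)
  -- A single inverse degree is at most the whole minimum, hence at most C' m^(-κ). So every degree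
  -- in the optimal set is at least m^κ / C', which beats the logarithmic threshold.
  have h1 : 1 / (deg (fun i => Y i ω) (2 * l + 1 + k) u : ℝ) ≤
      minInvSum l (2 * l + 1 + k) (deg (fun i => Y i ω) (2 * l + 1 + k)) := by
    rw [hmin]
    exact Finset.single_le_sum (f := fun v => 1 / (deg (fun i => Y i ω) (2 * l + 1 + k) v : ℝ))
      (fun _ _ => by positivity) hu
  set m := 2 * l + 1 + k with hm
  have hmκ : 0 ≤ (m : ℝ) ^ κ := by positivity
  have h2 : (m : ℝ) ^ κ * (1 / deg (fun i => Y i ω) m u) ≤ C' :=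
    (mul_le_mul_of_nonneg_left h1 hmκ).trans ((hC k).trans (le_max_left _ _))
  rw [mul_one_div, div_le_iff₀ (by linarith)] at h2
  rw [Real.norm_of_nonneg (by positivity), Real.norm_of_nonneg hmκ] at hn
  have h3 : (threshold m : ℝ) ≤ deg (fun i => Y i ω) m u := by
    refine hn.trans ?_
    rw [inv_mul_le_iff₀ (by linarith)]
    exact h2
  exact_mod_cast h3

end Growth

/-! ### Sorted lists and decreasing enumerations -/

/-- Induction on l: the largest entry `D (K 1)` is peeled off the head of the sorted list and the
enumeration shifts by one. The default 1 is never reached. -/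
theorem getD_sort_eq {V : Finset ℕ} {D K : ℕ → ℕ} {l : ℕ} (hl : 1 ≤ l)
    (hV : ∀ a, 1 ≤ a → a ≤ l → K a ∈ V)
    (hK : ∀ a b, 1 ≤ a → a < b → b ≤ l → D (K b) < D (K a))
    (hV' : ∀ i ∈ V, (∀ a, 1 ≤ a → a ≤ l → i ≠ K a) → D i ≤ D (K l)) :
    ((V.val.map D).sort (· ≥ ·)).getD (l - 1) 1 = D (K l) := by
  induction l, hl using Nat.le_induction generalizing V K with
  | base =>
    have h1 := hV 1 le_rfl le_rfl
    rw [← Finset.insert_erase h1, Finset.insert_val_of_notMem (Finset.notMem_erase _ _),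
      Multiset.map_cons, Multiset.sort_cons]
    · simp
    · intro b hb
      obtain ⟨i, hi, rfl⟩ := Multiset.mem_map.1 hb
      have hi' := Finset.mem_erase.1 (Finset.mem_val ▸ hi)
      exact hV' i hi'.2 fun a ha ha' => by
        obtain rfl : a = 1 := by omega
        exact hi'.1
  | succ l hl ih =>
    have h1 := hV 1 le_rfl (by omega)
    have hle : ∀ i ∈ V, D i ≤ D (K 1) := by
      intro i hi
      by_cases h : ∃ a, 1 ≤ a ∧ a ≤ l + 1 ∧ i = K a
      · obtain ⟨a, ha, ha', rfl⟩ := h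
        rcases ha.eq_or_lt with rfl | ha
        · rfl
        · exact (hK 1 a le_rfl ha ha').le
      · push Not at h
        exact (hV' i hi h).trans (hK 1 (l + 1) le_rfl (by omega) le_rfl).le
    rw [← Finset.insert_erase h1, Finset.insert_val_of_notMem (Finset.notMem_erase _ _),
      Multiset.map_cons, Multiset.sort_cons]
    · rw [show l + 1 - 1 = (l - 1) + 1 by omega, List.getD_cons_succ]
      refine ih (K := fun a => K (a + 1)) (fun a ha ha' => ?_) (fun a b ha hab hb =>
        hK _ _ (by omega) (by omega) (by omega)) fun i hi h => ?_
      · refine Finset.mem_erase.2 ⟨fun h => ?_, hV _ (by omega) (by omega)⟩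
        have := hK 1 (a + 1) le_rfl (by omega) (by omega)
        rw [h] at this
        exact lt_irrefl _ this
      · have hi' := Finset.mem_erase.1 hi
        refine hV' i hi'.2 fun a ha ha' => ?_
        rcases ha.eq_or_lt with rfl | ha
        · exact hi'.1
        · have := h (a - 1) (by omega) (by omega)
          rwa [show a - 1 + 1 = a by omega] at this
    · intro b hb
      obtain ⟨i, hi, rfl⟩ := Multiset.mem_map.1 hb
      exact hle i (Finset.mem_of_mem_erase (Finset.mem_val ▸ hi))

theorem exists_decreasing_enum (T : Finset ℕ) (f : ℕ → ℕ)
    (hf : ∀ u ∈ T, ∀ v ∈ T, u ≠ v → f u ≠ f v) :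
    ∃ K : ℕ → ℕ, (∀ a, 1 ≤ a → a ≤ T.card → K a ∈ T) ∧
      (∀ a b, 1 ≤ a → a < b → b ≤ T.card → f (K b) < f (K a)) ∧
      ∀ i ∈ T, ∃ a, 1 ≤ a ∧ a ≤ T.card ∧ K a = i := by
  induction hc : T.card generalizing T with
  | zero =>
    rw [Finset.card_eq_zero] at hc
    subst hc
    exact ⟨fun _ => 0, by omega, by omega, by simp⟩
  | succ c ih =>
    obtain ⟨i₀, hi₀, hmin⟩ := T.exists_min_image f (Finset.card_pos.1 (by omega))
    obtain ⟨K, h1, h2, h3⟩ := ih (T.erase i₀) (fun u hu v hv => hf u (Finset.mem_of_mem_erase hu)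
      v (Finset.mem_of_mem_erase hv)) (by rw [Finset.card_erase_of_mem hi₀]; omega)
    refine ⟨fun a => if a = c + 1 then i₀ else K a, fun a ha ha' => ?_, fun a b ha hab hb => ?_,
      fun i hi => ?_⟩
    · dsimp only
      split_ifs with h
      · exact hi₀
      · exact Finset.mem_of_mem_erase (h1 a ha (by omega))
    · dsimp only
      rw [if_neg (show a ≠ c + 1 by omega)]
      split_ifs with h
      · have ha' := Finset.mem_erase.1 (h1 a ha (by omega))
        exact lt_of_le_of_ne (hmin _ ha'.2) (hf _ hi₀ _ ha'.2 ha'.1.symm)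
      · exact h2 a b ha hab (by omega)
    · by_cases hii : i = i₀
      · exact ⟨c + 1, by omega, le_rfl, by simp [hii]⟩
      · obtain ⟨a, ha, ha', rfl⟩ := h3 i (Finset.mem_erase.2 ⟨hii, hi⟩)
        exact ⟨a, ha, by omega, if_neg (by omega)⟩

theorem tendsto_threshold : Filter.Tendsto threshold Filter.atTop Filter.atTop := by
  refine Filter.tendsto_atTop.2 fun L => ?_
  filter_upwards [Filter.eventually_ge_atTop (2 ^ L)] with n hn
  have := Nat.le_log_of_pow_le one_lt_two hn
  rw [threshold]
  omega

/-! ### Deterministic conclusion: the leaders freeze -/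

section Deterministic

variable {y : ℕ → ℕ} {k n₀ : ℕ}

/-- Late vertices always have at least `k` early vertices strictly above them. -/
theorem Admissible.card_filter_deg_lt (hy : Admissible y) (hn₀ : 1 ≤ n₀)
    (hA : ∀ n, n₀ ≤ n → ∀ u ∈ Finset.Icc 1 (n + 1), threshold n ≤ deg y (n + 1) u →
      ∀ m, n + 1 ≤ m → deg y m u ≠ deg y m (n + 2))
    (hG : ∀ n, n₀ ≤ n → ∃ U ∈ (Finset.Icc 1 (n + 1)).powersetCard k,
      ∀ u ∈ U, threshold n ≤ deg y n u)
    (v : ℕ) (hv : v ∉ Finset.Icc 1 (n₀ + 1)) {m : ℕ} (hm : n₀ ≤ m) :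
    k ≤ {i ∈ Finset.Icc 1 (n₀ + 1) | deg y m v < deg y m i}.card := by
  induction v using Nat.strong_induction_on with
  | _ v ih =>
    by_cases hvm : v ∈ Finset.Icc 1 (m + 1)
    · simp only [Finset.mem_Icc] at hv hvm
      -- The vertex v = n + 2 is born in P_{n+1}, when k older vertices are above the threshold; it
      -- never catches up with them. If one of these is itself late, it is older than v and the
      -- induction hypothesis applies to it.
      obtain ⟨n, rfl⟩ := Nat.exists_eq_add_of_le' (show 2 ≤ v by omega)
      obtain ⟨U, hU, hdeg⟩ := hG n (by omega)
      rw [Finset.mem_powersetCard] at hU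
      have hlt : ∀ u ∈ U, deg y m (n + 2) < deg y m u := by
        intro u hu
        have hle : threshold n ≤ deg y (n + 1) u :=
          (hdeg u hu).trans (hy.deg_mono (by omega) n.le_succ u)
        refine hy.deg_lt_of_ne (n := n + 1) (by omega) ?_ (by omega)
          (hA n (by omega) u (hU.1 hu) hle) (by omega)
        rw [hy.deg_newborn (by omega)]
        -- The summand 2 of the threshold puts it strictly above the newborn degree 1.
        rw [threshold] at hle
        omega
      by_cases hUS : U ⊆ Finset.Icc 1 (n₀ + 1)
      · rw [← hU.2]
        exact Finset.card_le_card fun u hu => Finset.mem_filter.2 ⟨hUS hu, hlt u hu⟩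
      · obtain ⟨u, hu, huS⟩ := Finset.not_subset.1 hUS
        have hun := Finset.mem_Icc.1 (hU.1 hu)
        refine (ih u (by omega) huS).trans (Finset.card_le_card fun i hi => ?_)
        rw [Finset.mem_filter] at hi ⊢
        exact ⟨hi.1, (hlt u hu).trans hi.2⟩
    -- An unborn v has degree 0, so any k early vertices are above it.
    · obtain ⟨U, hU, -⟩ := hG n₀ le_rfl
      rw [Finset.mem_powersetCard] at hU
      rw [← hU.2, hy.deg_eq_zero (hn₀.trans hm) hvm]
      refine Finset.card_le_card fun u hu => Finset.mem_filter.2 ⟨hU.1 hu, ?_⟩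
      have := hU.1 hu
      simp only [Finset.mem_Icc] at this
      exact hy.one_le_deg (hn₀.trans hm) (Finset.mem_Icc.2 (by omega))

/-- For every bound, at least `k` early vertices eventually have a larger degree. -/
theorem Admissible.exists_card_filter_lt (hy : Admissible y) (hn₀ : 1 ≤ n₀)
    (hA : ∀ n, n₀ ≤ n → ∀ u ∈ Finset.Icc 1 (n + 1), threshold n ≤ deg y (n + 1) u →
      ∀ m, n + 1 ≤ m → deg y m u ≠ deg y m (n + 2))
    (hG : ∀ n, n₀ ≤ n → ∃ U ∈ (Finset.Icc 1 (n + 1)).powersetCard k,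
      ∀ u ∈ U, threshold n ≤ deg y n u) (L : ℕ) :
    ∃ m, n₀ ≤ m ∧ k ≤ {i ∈ Finset.Icc 1 (n₀ + 1) | L < deg y m i}.card := by
  obtain ⟨m, hL, hm⟩ := ((tendsto_threshold.eventually_gt_atTop L).and
    (Filter.eventually_ge_atTop n₀)).exists
  refine ⟨m, hm, ?_⟩
  obtain ⟨U, hU, hdeg⟩ := hG m hm
  rw [Finset.mem_powersetCard] at hU
  by_cases hUS : U ⊆ Finset.Icc 1 (n₀ + 1)
  · rw [← hU.2]
    exact Finset.card_le_card fun u hu =>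
      Finset.mem_filter.2 ⟨hUS hu, hL.trans_le (hdeg u hu)⟩
  · obtain ⟨u, hu, huS⟩ := Finset.not_subset.1 hUS
    refine (hy.card_filter_deg_lt hn₀ hA hG u huS hm).trans
      (Finset.card_le_card fun i hi => ?_)
    rw [Finset.mem_filter] at hi ⊢
    exact ⟨hi.1, (hL.trans_le (hdeg u hu)).trans hi.2⟩

/-- The `k` leading vertices are eventually constant, with distinct degrees. -/
theorem Admissible.exists_leaders (hy : Admissible y)
    (hA : ∀ᶠ n in Filter.atTop, ∀ u ∈ Finset.Icc 1 (n + 1), threshold n ≤ deg y (n + 1) u →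
      ∀ m, n + 1 ≤ m → deg y m u ≠ deg y m (n + 2))
    (hG : ∀ᶠ n in Filter.atTop, ∃ U ∈ (Finset.Icc 1 (n + 1)).powersetCard k,
      ∀ u ∈ U, threshold n ≤ deg y n u)
    (hT : ∀ u v, u ≠ v → 1 ≤ u → 1 ≤ v → ∃ C : ℕ, ∀ n, u + v ≤ n → deg y n u = deg y n v →
      deg y n u ≤ C) :
    ∃ (N : ℕ) (K : ℕ → ℕ), 1 ≤ N ∧ ∀ n, N ≤ n →
      (∀ a b, 1 ≤ a → a < b → b ≤ k → deg y n (K b) < deg y n (K a)) ∧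
      ∀ i, (∀ a, 1 ≤ a → a ≤ k → i ≠ K a) → ∀ a, 1 ≤ a → a ≤ k → deg y n i < deg y n (K a) := by
  classical
  obtain ⟨n₀, h₀⟩ := Filter.eventually_atTop.1
    ((hA.and hG).and (Filter.eventually_ge_atTop 1))
  have hn₀ := (h₀ n₀ le_rfl).2
  replace hA := fun n hn => (h₀ n hn).1.1
  replace hG := fun n hn => (h₀ n hn).1.2
  have hS1 := fun v => hy.card_filter_deg_lt hn₀ hA hG v
  have hS2 := hy.exists_card_filter_lt hn₀ hA hG
  clear hA hG h₀
  set S := Finset.Icc 1 (n₀ + 1) with hS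
  -- T consists of the early vertices of unbounded degree; it is finite and will contain the
  -- leaders.
  set T := {i ∈ S | ∀ L, ∃ m, 1 ≤ m ∧ L < deg y m i} with hTdef
  have hTS : T ⊆ S := Finset.filter_subset _ _
  have hL1 : ∀ᶠ L in Filter.atTop, ∀ i ∈ S \ T, ∀ m, 1 ≤ m → deg y m i ≤ L := by
    refine (Filter.eventually_all_finset _).2 fun i hi => ?_
    rw [Finset.mem_sdiff, hTdef, Finset.mem_filter, not_and] at hi
    have := hi.2 hi.1
    push Not at this
    obtain ⟨L, hL⟩ := this
    filter_upwards [Filter.eventually_ge_atTop L] with L' hL' m hm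
    exact (hL m hm).trans hL'
  have hL2 : ∀ᶠ L in Filter.atTop, ∀ u ∈ T, ∀ v ∈ T, u ≠ v → ∀ n, u + v ≤ n →
      deg y n u = deg y n v → deg y n u ≤ L := by
    refine (Filter.eventually_all_finset _).2 fun u hu =>
      (Filter.eventually_all_finset _).2 fun v hv => ?_
    by_cases huv : u = v
    · exact Filter.Eventually.of_forall fun _ h => absurd huv h
    obtain ⟨C, hC⟩ := hT u v huv (Finset.mem_Icc.1 (hTS hu)).1 (Finset.mem_Icc.1 (hTS hv)).1
    filter_upwards [Filter.eventually_ge_atTop C] with L hL _ n hn heq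
    exact (hC n hn heq).trans hL
  -- One level L bounds all degrees in S \ T and the degree at every tie within T (once both
  -- vertices are born). Above L neither occurs.
  obtain ⟨L, hLS, hLT⟩ := (hL1.and hL2).exists
  have hkT : k ≤ T.card := by
    obtain ⟨m, hm, hcard⟩ := hS2 L
    refine hcard.trans (Finset.card_le_card fun i hi => ?_)
    rw [Finset.mem_filter] at hi
    by_contra hiT
    exact absurd (hLS i (Finset.mem_sdiff.2 ⟨hi.1, hiT⟩) m (hn₀.trans hm)) (not_le.2 hi.2)
  have hN1 : ∀ᶠ N in Filter.atTop, ∀ i ∈ T, L < deg y N i := by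
    refine (Filter.eventually_all_finset _).2 fun i hi => ?_
    obtain ⟨m, hm, hlt⟩ := (Finset.mem_filter.1 hi).2 L
    filter_upwards [Filter.eventually_ge_atTop m] with N hN
    exact hlt.trans_le (hy.deg_mono hm hN i)
  -- N ≥ 2(n₀ + 1) ensures u + v ≤ n for all u, v in S, as the tie bound requires.
  obtain ⟨N, hNT, hN⟩ := (hN1.and (Filter.eventually_ge_atTop (2 * (n₀ + 1)))).exists
  have hT_gt : ∀ i ∈ T, ∀ n, N ≤ n → L < deg y n i := fun i hi n hn =>
    (hNT i hi).trans_le (hy.deg_mono (by omega) hn i)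
  have hne : ∀ u ∈ T, ∀ v ∈ T, u ≠ v → ∀ n, N ≤ n → deg y n u ≠ deg y n v := by
    intro u hu v hv huv n hn heq
    have h1 := Finset.mem_Icc.1 (hTS hu)
    have h2 := Finset.mem_Icc.1 (hTS hv)
    exact absurd (hLT u hu v hv huv n (by omega) heq) (not_le.2 (hT_gt u hu n hn))
  obtain ⟨K, hK1, hK2, hK3⟩ := exists_decreasing_enum T (deg y N) fun u hu v hv huv =>
    hne u hu v hv huv N le_rfl
  have hlt : ∀ n, N ≤ n → ∀ a b, 1 ≤ a → a < b → b ≤ T.card →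
      deg y n (K b) < deg y n (K a) := by
    intro n hn a b ha hab hb
    have hlt := hK2 a b ha hab hb
    have hKa := hK1 a ha (by omega)
    have hKb := hK1 b (by omega) hb
    have h1 := Finset.mem_Icc.1 (hTS hKb)
    exact hy.deg_lt_of_ne (by omega) hlt (by omega) (hne _ hKa _ hKb fun h => by
      rw [h] at hlt; exact lt_irrefl _ hlt) hn
  refine ⟨N, K, by omega, fun n hn => ⟨fun a b ha hab hb => hlt n hn a b ha hab (hb.trans hkT),
    fun i hi j hj1 hj2 => ?_⟩⟩
  have hKj := hK1 j hj1 (hj2.trans hkT)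
  by_cases hiS : i ∈ S
  · by_cases hiT : i ∈ T
    · obtain ⟨a, ha1, ha2, rfl⟩ := hK3 i hiT
      have hka : k < a := by
        by_contra hle
        exact hi a ha1 (not_lt.1 hle) rfl
      exact hlt n hn j a hj1 (by omega) ha2
    · exact (hLS i (Finset.mem_sdiff.2 ⟨hiS, hiT⟩) n (by omega)).trans_lt (hT_gt _ hKj n hn)
  · by_contra hcon
    rw [not_lt] at hcon
    -- If a late i reached the degree of K j, then the early vertices above i would be among K 1, …,
    -- K (j - 1): fewer than k of them, a contradiction.
    have hsub : {t ∈ S | deg y n i < deg y n t} ⊆ (Finset.Icc 1 (j - 1)).image K := by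
      intro t ht
      rw [Finset.mem_filter] at ht
      have htj := hcon.trans_lt ht.2
      have htT : t ∈ T := by
        by_contra htT
        have h1 := hLS t (Finset.mem_sdiff.2 ⟨ht.1, htT⟩) n (by omega)
        have h2 := hT_gt _ hKj n hn
        omega
      obtain ⟨a, ha1, ha2, rfl⟩ := hK3 t htT
      refine Finset.mem_image.2 ⟨a, Finset.mem_Icc.2 ⟨ha1, ?_⟩, rfl⟩
      by_contra haj
      rcases (show j ≤ a by omega).eq_or_lt with rfl | hja
      · exact lt_irrefl _ htj
      · exact lt_asymm htj (hlt n hn j a hj1 hja ha2)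
    have h1 := (hS1 i hiS (show n₀ ≤ n by omega)).trans
      ((Finset.card_le_card hsub).trans Finset.card_image_le)
    rw [Nat.card_Icc] at h1
    omega

end Deterministic

/-! ### Leaders in terms of sorted degrees, and measurable selection -/

/-- The conclusion at a single time `n` for the `l` leading vertices `K 1, …, K l`. -/
def LeadersAt (y K : ℕ → ℕ) (l n : ℕ) : Prop :=
  deg y n (K l) = maxDeg y l n ∧
    (∀ a b, 1 ≤ a → a < b → b ≤ l → maxDeg y b n < maxDeg y a n) ∧
    ∀ i, (∀ j ∈ Finset.Icc 1 l, i ≠ K j) → deg y n i < maxDeg y l n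

theorem LeadersAt.congr {y K K' : ℕ → ℕ} {l n : ℕ} (hl : 1 ≤ l)
    (hK : ∀ j ∈ Finset.Icc 1 l, K j = K' j) (h : LeadersAt y K l n) : LeadersAt y K' l n := by
  refine ⟨hK l (Finset.mem_Icc.2 ⟨hl, le_rfl⟩) ▸ h.1, h.2.1, fun i hi => h.2.2 i fun j hj => ?_⟩
  rw [hK j hj]
  exact hi j hj

theorem Admissible.leadersAt {y K : ℕ → ℕ} {k n : ℕ} (hy : Admissible y) (hn : 1 ≤ n)
    (hK : ∀ a b, 1 ≤ a → a < b → b ≤ k → deg y n (K b) < deg y n (K a))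
    (hK' : ∀ i, (∀ a, 1 ≤ a → a ≤ k → i ≠ K a) →
      ∀ a, 1 ≤ a → a ≤ k → deg y n i < deg y n (K a)) {l : ℕ} (hl : l ∈ Finset.Icc 1 k) :
    LeadersAt y K l n := by
  rw [Finset.mem_Icc] at hl
  have hlow : ∀ l, 1 ≤ l → l ≤ k → ∀ i, (∀ a, 1 ≤ a → a ≤ l → i ≠ K a) →
      deg y n i < deg y n (K l) := by
    intro l hl1 hlk i hi
    by_cases h : ∃ a, 1 ≤ a ∧ a ≤ k ∧ i = K a
    · obtain ⟨a, ha1, hak, rfl⟩ := h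
      refine hK l a hl1 ?_ hak
      by_contra hla
      exact hi a ha1 (not_lt.1 hla) rfl
    · push Not at h
      exact hK' i h l hl1 hlk
  have hmem : ∀ a, 1 ≤ a → a ≤ k → K a ∈ Finset.Icc 1 (n + 1) := by
    intro a ha1 hak
    refine hy.mem_of_deg_pos hn ?_
    by_contra h0
    -- An index outside both the tree and the leaders has degree 0 and lies strictly below every
    -- leader, so leaders have positive degree and are vertices.
    obtain ⟨i, hi, hne⟩ : ∃ i, i ∉ (Finset.Icc 1 k).image K ∧ deg y n i = 0 := by
      obtain ⟨i, hi⟩ := Infinite.exists_notMem_finset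
        ((Finset.Icc 1 k).image K ∪ Finset.Icc 1 (n + 1))
      rw [Finset.notMem_union] at hi
      exact ⟨i, hi.1, hy.deg_eq_zero hn hi.2⟩
    have := hK' i (fun b hb1 hbk h => hi (Finset.mem_image.2
      ⟨b, Finset.mem_Icc.2 ⟨hb1, hbk⟩, h.symm⟩)) a ha1 hak
    omega
  have hmax : ∀ l, 1 ≤ l → l ≤ k → maxDeg y l n = deg y n (K l) := fun l hl1 hlk =>
    getD_sort_eq hl1 (fun a ha hal => hmem a ha (hal.trans hlk))
      (fun a b ha hab hb => hK a b ha hab (hb.trans hlk)) fun i _ hi => (hlow l hl1 hlk i hi).le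
  refine ⟨(hmax l hl.1 hl.2).symm, fun a b ha hab hbl => ?_, fun i hi => ?_⟩
  · rw [hmax a ha (by omega), hmax b (by omega) (by omega)]
    exact hK a b ha hab (by omega)
  · rw [hmax l hl.1 hl.2]
    exact hlow l hl.1 hl.2 i fun a ha hal => hi a (Finset.mem_Icc.2 ⟨ha, hal⟩)

theorem measurableSet_leadersAt {Ω : Type*} [MeasurableSpace Ω] {Y : ℕ → Ω → ℕ}
    (hY : ∀ n, 1 ≤ n → Measurable (Y n)) (K : ℕ → ℕ) (l : ℕ) {n : ℕ} (hn : 1 ≤ n) :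
    MeasurableSet {ω | LeadersAt (fun i => Y i ω) K l n} :=
  measurableSet_tree hY hn {t : SimpleGraph ℕ |
    let D : ℕ → ℕ := fun i => (t.neighborSet i).ncard
    let M : ℕ → ℕ := fun l =>
      (((Finset.Icc 1 (n + 1)).val.map D).sort (· ≥ ·)).getD (l - 1) 1
    D (K l) = M l ∧ (∀ a b, 1 ≤ a → a < b → b ≤ l → M b < M a) ∧
      ∀ i, (∀ j ∈ Finset.Icc 1 l, i ≠ K j) → D i < M l}

/-- Taking the first suitable element of an enumeration of a countable type gives a measurable
choice. -/
theorem exists_measurable_select {Ω α : Type*} [MeasurableSpace Ω] [Countable α] [Nonempty α]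
    (Q : α → Set Ω) (hQ : ∀ c, MeasurableSet (Q c)) :
    ∃ F : Ω → α, (∀ g : α → ℕ, Measurable fun ω => g (F ω)) ∧
      ∀ ω, (∃ c, ω ∈ Q c) → ω ∈ Q (F ω) := by
  classical
  obtain ⟨e, he⟩ := exists_surjective_nat α
  -- The complement of the union is adjoined so that the search ends even where no element is
  -- suitable.
  have hex : ∀ ω, ∃ n, ω ∈ Q (e n) ∪ (⋃ c, Q c)ᶜ := by
    intro ω
    by_cases h : ω ∈ ⋃ c, Q c
    · obtain ⟨c, hc⟩ := Set.mem_iUnion.1 h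
      obtain ⟨n, rfl⟩ := he c
      exact ⟨n, Or.inl hc⟩
    · exact ⟨0, Or.inr h⟩
  have hm : Measurable fun ω => Nat.find (hex ω) :=
    measurable_find hex fun n => (hQ (e n)).union (MeasurableSet.iUnion hQ).compl
  refine ⟨fun ω => e (Nat.find (hex ω)), fun g => (measurable_of_countable (g ∘ e)).comp hm,
    fun ω hω => ?_⟩
  exact (Nat.find_spec (hex ω)).resolve_right fun h => h (Set.mem_iUnion.2 hω)

end MaxChoice

theorem proposition1p2 {Ω : Type*} [MeasurableSpace Ω] (μ : Measure Ω) [IsProbabilityMeasure μ]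
    (d : ℕ) (hd : 2 ≤ d) (X : ℕ → Fin d → Ω → ℕ) (Y : ℕ → Ω → ℕ)
    (h : MaxChoice.IsMaxChoiceTree μ d X Y) (k : ℕ) :
    ∃ N K : ℕ → Ω → ℕ,
      (∀ l ∈ Finset.Icc 1 k, Measurable (N l) ∧ Measurable (K l)) ∧
      ∀ᵐ ω ∂μ, ∀ l ∈ Finset.Icc 1 k, ∀ n, N l ω ≤ n →
        MaxChoice.deg (fun i => Y i ω) n (K l ω) = MaxChoice.maxDeg (fun i => Y i ω) l n ∧
        (∀ a b, 1 ≤ a → a < b → b ≤ l →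
          MaxChoice.maxDeg (fun i => Y i ω) b n < MaxChoice.maxDeg (fun i => Y i ω) a n) ∧
        ∀ i, (∀ j ∈ Finset.Icc 1 l, i ≠ K j ω) →
          MaxChoice.deg (fun i => Y i ω) n i < MaxChoice.maxDeg (fun i => Y i ω) l n := by
  -- Only K 1, …, K k matter, so time and leaders are coded in the countable type `ℕ × List ℕ`. The
  -- shift by 1 keeps times at least 1, where the tree is P_n.
  obtain ⟨F, hF, hFQ⟩ := MaxChoice.exists_measurable_select (Ω := Ω) (α := ℕ × List ℕ)
    (fun c => ⋂ l ∈ Finset.Icc 1 k, ⋂ n, ⋂ (_ : c.1 + 1 ≤ n),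
      {ω | MaxChoice.LeadersAt (fun i => Y i ω) (fun j => c.2.getD j 0) l n})
    fun c => Finset.measurableSet_biInter _ fun l _ => MeasurableSet.iInter fun n =>
      MeasurableSet.iInter fun hn =>
        MaxChoice.measurableSet_leadersAt h.measurable_Y _ l (by omega)
  refine ⟨fun _ ω => (F ω).1 + 1, fun l ω => (F ω).2.getD l 0,
    fun l _ => ⟨hF fun c => c.1 + 1, hF fun c => c.2.getD l 0⟩, ?_⟩
  have hT : ∀ᵐ ω ∂μ, ∀ u v, u ≠ v → 1 ≤ u → 1 ≤ v → ∃ C : ℕ, ∀ n, u + v ≤ n →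
      MaxChoice.deg (fun i => Y i ω) n u = MaxChoice.deg (fun i => Y i ω) n v →
      MaxChoice.deg (fun i => Y i ω) n u ≤ C := by
    simp only [ae_all_iff]
    exact fun u v huv hu hv => h.ae_exists_forall_deg_le huv hu hv
  filter_upwards [h.ae_eventually_ne, h.ae_eventually_threshold (by omega) k, hT]
    with ω hA hG hT l hl n hn
  have hadm := h.admissible ω
  obtain ⟨N, K, hN, hNK⟩ := hadm.exists_leaders hA hG hT
  -- The list holds K 0, …, K k, so that position j is K j; the entry K 0 is padding.
  have hω := hFQ ω ⟨(N, (List.range (k + 1)).map K), ?_⟩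
  · simp only [Set.mem_iInter] at hω
    exact hω l hl n hn
  · simp only [Set.mem_iInter]
    intro l hl n hn
    obtain ⟨h1, h2⟩ := hNK n (by omega)
    change MaxChoice.LeadersAt _ (fun j => ((List.range (k + 1)).map K).getD j 0) l n
    refine (hadm.leadersAt (by omega) h1 h2 hl).congr (Finset.mem_Icc.1 hl).1 fun j hj => ?_
    simp only [Finset.mem_Icc] at hj hl
    rw [List.getD_eq_getElem _ _ (by simp; omega)]
    simp
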